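/- **Setting.** Let $a=x_0<x_1<\dots<x_k<x_{k+1}=b$, $I=[a,b]$, $I_i=[x_i,x_{i+1}]$. A *piecewise function* $F$ on $I$ is a family of functions $F^{[i]}:I_i\to\mathbb R$, $i=0,\dots,k$; it is *piecewise $C^n$* if every $F^{[i]}$ is $C^n$ on $I_i$, it is *positive* if every $F^{[i]}$ is positive on $I_i$, and $D$ denotes piecewise differentiation. An *$m$-dimensional EC-space* on $I_i$ ($m\ge 1$) is an $m$-dimensional linear space of $C^{m-1}$ functions on $I_i$ whose nonzero elements have at most $m-1$ zeros in $I_i$, counted with multiplicities up to $m$. For $i=0,\dots,k$ let $\mathcal U_{i,m}$ be an $m$-dimensional EC-space on $I_i$, and for $i=1,\dots,k$ let $R_i$ be a lower triangular $m\times m$ matrix with positive diagonal entries and with first row and first column equal to $(1,0,\dots,0)$. The *spline space with knots of zero multiplicity* $S$ is the set of all piecewise $C^{m-1}$ functions $F$ with $F^{[i]}\in\mathcal U_{i,m}$ for all $i$ and $$(D^0F^{[i]}(x_i),\dots,D^{m-1}F^{[i]}(x_i))^T=R_i\,(D^0F^{[i-1]}(x_i),\dots,D^{m-1}F^{[i-1]}(x_i))^T,\quad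 i=1,\dots,k.$$ Put $DS=\{DF : F\in S\}$, and assume that $S$ contains the constants. An *$n$-dimensional ECP-space* ($n\ge1$) is an $n$-dimensional linear space of piecewise $C^{n-1}$ functions whose nonzero elements have at most $n-1$ zeros in $I$, counted with multiplicities up to $n$ (in $S$ and $DS$ the multiplicities of a zero at $x_i^-$ and at $x_i^+$ agree). A *system of piecewise weight functions* $\{w_0,\dots,w_{n-1}\}$ consists of positive piecewise functions with $w_j$ piecewise $C^{n-j-1}$. With $L_0F=F/w_0$ and $L_jF=\frac1{w_j}DL_{j-1}F$, let $ECP(w_0,\dots,w_{n-1})$ be the set of all piecewise $C^{n-1}$ functions $F$ such that $L_{n-1}F$ is constant on $I$ and $L_jF^{[i]}(x_i)=L_jF^{[i-1]}(x_i)$ for $i=1,\dots,k$, $j=0,\dots,n-1$. The system is *associated with* a space $V$ if $V=ECP(w_0,\dots,w_{n-1})$. *Transition functions* of $S$ are functions $f_{1,m},\dots,f_{m,m}\in S$ with $f_{1,m}\equiv1$ and, for $\ell=2,\dots,m$, $D^rf_{\ell,m}(a)=0$ for $r=0,\dots,\ell-2$ and $D^rf_{\ell,m}(b)=\delta_{r,0}$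 for $r=0,\dots,m-\ell$. From them define recursively $w_0=1$ and, for $j=1,\dots,m-1$, $$w_j=\sum_{\ell=2}^{m-j+1}Df_{\ell,m-j+1},\qquad f_{\ell,m-j}=\frac{\sum_{h=\ell+1}^{m-j+1}Df_{h,m-j+1}}{w_j},\quad \ell=1,\dots,m-j .$$ **Proposition.** Suppose that $DS$ is an $(m-1)$-dimensional ECP-space. Then $S$ is an $m$-dimensional ECP-space, the transition functions of $S$ exist, are unique and are linearly independent, the functions $w_1,\dots,w_{m-1}$ are positive, $\{1,w_1,\dots,w_{m-1}\}$ is a system of piecewise weight functions associated with $S$, and $\{w_1,\dots,w_{m-1}\}$ is a system of piecewise weight functions associated with $DS$. Consequently, if transition functions of $S$ exist and some $w_j$, $1\le j\le m-1$, fails to be positive (the recursion being stopped at the first such $j$), then $DS$ is not an ECP-space, and there is no system of piecewise weight functions $\{1,v_1,\dots,v_{m-1}\}$ with first member $1$ that is associated with $S$. -/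

import Mathlib

noncomputable section

namespace PCSpline

/-! ### Functions on one closed interval -/

/-- The ordinary derivative of a function on `[c, d]`, one-sided at the end points. -/
def segDeriv {c d : ℝ} (f : Set.Icc c d → ℝ) : Set.Icc c d → ℝ :=
  fun t => derivWithin (Function.extend Subtype.val f 0) (Set.Icc c d) t

/-- `f` is of class `C^n` on the closed interval `[c, d]`. -/
def SegContDiff {c d : ℝ} (n : ℕ) (f : Set.Icc c d → ℝ) : Prop :=
  ContDiffOn ℝ n (Function.extend Subtype.val f 0) (Set.Icc c d)

open Classical in
/-- The multiplicity of `t` as a zero of `f`, counted up to `n`: the greatest `r ≤ n` such that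
`D^s f (t) = 0` for all `s < r`. -/
def segZeroMult {c d : ℝ} (n : ℕ) (f : Set.Icc c d → ℝ) (t : Set.Icc c d) : ℕ :=
  Nat.findGreatest (fun r => ∀ s < r, (segDeriv^[s] f) t = 0) n

/-- The total number of zeros of `f` in `[c, d]`, with multiplicities counted up to `n`. -/
def segNumZeros {c d : ℝ} (n : ℕ) (f : Set.Icc c d → ℝ) : ℕ∞ :=
  ⨆ T : Finset (Set.Icc c d), ((∑ t ∈ T, segZeroMult n f t : ℕ) : ℕ∞)

/-- `U` is an `n`-dimensional Extended Chebyshev space on `[c, d]`. -/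
structure IsECSpace {c d : ℝ} (n : ℕ) (U : Submodule ℝ (Set.Icc c d → ℝ)) : Prop where
  one_le : 1 ≤ n
  finrank_eq : Module.finrank ℝ U = n
  contDiff : ∀ f ∈ U, SegContDiff (n - 1) f
  numZeros_le : ∀ f ∈ U, f ≠ 0 → segNumZeros n f ≤ ((n - 1 : ℕ) : ℕ∞)

/-! ### Piecewise functions -/

/-- A partition `a = x_0 < x_1 < ... < x_k < x_{k+1} = b`, where `pt i` is `x_i`. -/
structure Knots (k : ℕ) where
  pt : Fin (k + 2) → ℝ
  strictMono : StrictMono pt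

variable {k : ℕ}

/-- The `i`-th closed interval `I_i = [x_i, x_{i+1}]`, for `i = 0, ..., k`. -/
abbrev Knots.Seg (X : Knots k) (i : Fin (k + 1)) : Type :=
  Set.Icc (X.pt i.castSucc) (X.pt i.succ)

/-- The left end point of `I_i`. -/
def Knots.left (X : Knots k) (i : Fin (k + 1)) : X.Seg i :=
  ⟨X.pt i.castSucc, Set.left_mem_Icc.2 (X.strictMono i.castSucc_lt_succ).le⟩

/-- The right end point of `I_i`. -/
def Knots.right (X : Knots k) (i : Fin (k + 1)) : X.Seg i :=
  ⟨X.pt i.succ, Set.right_mem_Icc.2 (X.strictMono i.castSucc_lt_succ).le⟩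

/-- A piecewise function: one function on each closed interval `I_i`, so that at every interior
knot it has a value from the left and a value from the right, which may differ. -/
abbrev PFun (X : Knots k) : Type := (i : Fin (k + 1)) → X.Seg i → ℝ

variable {X : Knots k}

/-- Ordinary differentiation, meant piecewise. -/
def pderiv (F : PFun X) : PFun X := fun i => segDeriv (F i)

/-- `F` is piecewise `C^n`. -/
def PContDiff (n : ℕ) (F : PFun X) : Prop := ∀ i, SegContDiff n (F i)

/-- `F` is positive on the whole interval, from both sides at the interior knots. -/
def PPositive (F : PFun X) : Prop := ∀ i t, 0 < F i t

open Classical in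
/-- The multiplicity of the point `t` as a zero of the piecewise function `F`, counted up to `n`.
At an interior knot the derivatives have to vanish from the left and from the right; in the spaces
below the multiplicities from the two sides always agree. -/
def zeroMult (n : ℕ) (F : PFun X) (t : ℝ) : ℕ :=
  Nat.findGreatest (fun r => ∀ s < r, ∀ (i : Fin (k + 1))
    (h : t ∈ Set.Icc (X.pt i.castSucc) (X.pt i.succ)), (segDeriv^[s] (F i)) ⟨t, h⟩ = 0) n

/-- `Z_n(F)`: the total number of zeros of `F` in `[a, b]`, with multiplicities up to `n`. -/
def numZeros (n : ℕ) (F : PFun X) : ℕ∞ :=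
  ⨆ T : Finset (Set.Icc (X.pt 0) (X.pt (Fin.last (k + 1)))),
    ((∑ t ∈ T, zeroMult n F t : ℕ) : ℕ∞)

/-- The set `V` of piecewise functions is an `n`-dimensional Extended Chebyshev Piecewise space:
a linear space of dimension `n` of piecewise `C^{n-1}` functions, whose nonzero elements have at
most `n - 1` zeros. -/
structure IsECPSpace (n : ℕ) (V : Set (PFun X)) : Prop where
  one_le : 1 ≤ n
  linear : ∃ W : Submodule ℝ (PFun X), (W : Set (PFun X)) = V ∧ Module.finrank ℝ W = n
  contDiff : ∀ F ∈ V, PContDiff (n - 1) F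
  numZeros_le : ∀ F ∈ V, F ≠ 0 → numZeros n F ≤ ((n - 1 : ℕ) : ℕ∞)

/-! ### Spline spaces with knots of zero multiplicity -/

/-- The conditions on a connection matrix: lower triangular, positive diagonal entries, first row
and first column equal to `(1, 0, ..., 0)`. -/
structure IsConnectionMatrix {m : ℕ} (R : Matrix (Fin m) (Fin m) ℝ) : Prop where
  lower : ∀ r c, r < c → R r c = 0
  diag_pos : ∀ r, 0 < R r r
  first_row : ∀ r c, r.val = 0 → R r c = if c.val = 0 then 1 else 0
  first_col : ∀ r c, c.val = 0 → R r c = if r.val = 0 then 1 else 0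

/-- The column vector `(D^0 f (t), ..., D^{m-1} f (t))`. -/
def jet {c d : ℝ} (m : ℕ) (f : Set.Icc c d → ℝ) (t : Set.Icc c d) : Fin m → ℝ :=
  fun r => (segDeriv^[r.val] f) t

/-- The spline space `S(U, Δ, R)` with knots of zero multiplicity. For `i : Fin k` the matrix `R i`
belongs to the interior knot that ends the interval `i.castSucc` and starts the interval
`i.succ`. -/
def splineSpace {m : ℕ} (X : Knots k) (U : (i : Fin (k + 1)) → Submodule ℝ (X.Seg i → ℝ))
    (R : Fin k → Matrix (Fin m) (Fin m) ℝ) : Set (PFun X) :=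
  {s | PContDiff (m - 1) s ∧ (∀ i, s i ∈ U i) ∧
    ∀ i : Fin k, jet m (s i.succ) (X.left i.succ) =
      Matrix.mulVec (R i) (jet m (s i.castSucc) (X.right i.castSucc))}

/-- `DS`, the set of all derivatives of elements of `S`. -/
def derivSpace (S : Set (PFun X)) : Set (PFun X) := pderiv '' S

/-! ### Piecewise weight functions -/

/-- `w 0, ..., w (n - 1)` is a system of piecewise weight functions (later values of `w` play no
role). -/
def IsWeightSystem (n : ℕ) (w : ℕ → PFun X) : Prop :=
  ∀ j < n, PPositive (w j) ∧ PContDiff (n - j - 1) (w j)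

/-- The generalized derivatives `L_0 F = F / w_0`, `L_j F = (D L_{j-1} F) / w_j`. -/
def genDeriv (w : ℕ → PFun X) : ℕ → PFun X → PFun X
  | 0, F => F / w 0
  | j + 1, F => pderiv (genDeriv w j F) / w (j + 1)

/-- `ECP(w_0, ..., w_{n-1})`: the set of all piecewise `C^{n-1}` functions `F` such that
`L_{n-1} F` is constant and `L_0 F, ..., L_{n-1} F` have no jump at the interior knots. -/
def ecpSet (n : ℕ) (w : ℕ → PFun X) : Set (PFun X) :=
  {F | PContDiff (n - 1) F ∧ (∃ c : ℝ, ∀ i t, genDeriv w (n - 1) F i t = c) ∧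
    ∀ i : Fin k, ∀ j < n, genDeriv w j F i.succ (X.left i.succ) =
      genDeriv w j F i.castSucc (X.right i.castSucc)}

/-- `w 0, ..., w (n - 1)` is a system of piecewise weight functions associated with `V`, that is,
`V = ECP(w_0, ..., w_{n-1})`. -/
def IsAssociated (n : ℕ) (w : ℕ → PFun X) (V : Set (PFun X)) : Prop :=
  IsWeightSystem n w ∧ V = ecpSet n w

/-! ### Transition functions and the functions built from them -/

/-- `f 1, ..., f m` are transition functions of `S` relative to `[a, b]` (other values of `f` play
no role). -/
structure IsTransition (m : ℕ) (S : Set (PFun X)) (f : ℕ → PFun X) : Prop where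
  mem : ∀ l ∈ Finset.Icc 1 m, f l ∈ S
  one : f 1 = 1
  at_left : ∀ l ∈ Finset.Icc 2 m, ∀ r, r ≤ l - 2 → (segDeriv^[r] (f l 0)) (X.left 0) = 0
  at_right : ∀ l ∈ Finset.Icc 2 m, ∀ r, r ≤ m - l →
    (segDeriv^[r] (f l (Fin.last k))) (X.right (Fin.last k)) = if r = 0 then 1 else 0

/-- `transFam m f j l` is the function `f_{l, m-j}`: for `j = 0` it is the given `f l`, and
`f_{l, m-j} = (∑_{h=l+1}^{m-j+1} D f_{h, m-j+1}) / (∑_{h=2}^{m-j+1} D f_{h, m-j+1})`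
for `j ≥ 1`. -/
def transFam (m : ℕ) (f : ℕ → PFun X) : ℕ → ℕ → PFun X
  | 0 => f
  | j + 1 => fun l =>
      (∑ h ∈ Finset.Icc (l + 1) (m - j), pderiv (transFam m f j h)) /
        (∑ h ∈ Finset.Icc 2 (m - j), pderiv (transFam m f j h))

/-- The functions `w_0 = 1` and `w_j = ∑_{l=2}^{m-j+1} D f_{l, m-j+1}` for `j ≥ 1`. -/
def weight (m : ℕ) (f : ℕ → PFun X) : ℕ → PFun X
  | 0 => 1
  | j + 1 => ∑ l ∈ Finset.Icc 2 (m - j), pderiv (transFam m f j l)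

end PCSpline

end

/-! The engine is total positivity of Wronskians. Put n = m - 1 and E = DS. The derivative of the
transition function f_l vanishes to order l - 2 at a and m - l at b. If a Wronskian of consecutive
derivatives Df_p, ..., Df_{p+r-1} vanished at an interior point, some nontrivial combination would
have an r-fold zero there besides its zeros at a and b, n zeros in all, which the ECP property of E
forbids. So these Wronskians have no interior zero; the connection matrices preserve their sign
across knots, and near a the sign is that of the product of the leading coefficients
(`exists_segWr_sign`). The coefficients are positive because f_l climbs from 0 to 1 with a
derivative of constant sign. Fekete's criterion (`initialMinor_pos_of_consecutive`) extends
positivity to all increasing index sets, and continuity gives nonnegativity up to the end points.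
The full Wronskian is positive everywhere, since an n-fold zero at any point is excluded.

This property passes from one step of the recursion to the next (`IsTotallyPositiveLevel.next`).
With w the sum of the DT_h and V_l the tail sums divided by w, one has V_1 = 1, so W(DV_J) = W(1,
V_J), and multiplying by a power of w gives a Wronskian of tail sums. Column operations and
multilinearity turn it into a sum of Wronskians of the DT_h. In particular every w_j is positive.

The association with S and DS follows because a function lies in one level exactly when it has no
jumps and its derivative divided by w lies in the next (`mem_iff_next`): antiderivatives without
jumps differ by a constant, and constants belong to every level.

The converse needs only Rolle's theorem. If weights with first member 1 are associated with S,
counting zeros back from the constant last generalized derivative bounds the zeros of DF, so DS is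
an ECP-space. A nonpositive w_j therefore excludes both. -/

namespace PCSpline

/-! ### Calculus on one closed interval -/

section Segment

variable {c d : ℝ}

/-- The extension by zero of a function on `[c, d]`. -/
noncomputable def segExt (f : Set.Icc c d → ℝ) : ℝ → ℝ := Function.extend Subtype.val f 0

theorem segExt_coe (f : Set.Icc c d → ℝ) (t : Set.Icc c d) : segExt f t = f t :=
  Subtype.val_injective.extend_apply f 0 t

theorem segExt_of_mem (f : Set.Icc c d → ℝ) {t : ℝ} (ht : t ∈ Set.Icc c d) :
    segExt f t = f ⟨t, ht⟩ := segExt_coe f ⟨t, ht⟩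

theorem segContDiff_iff {n : ℕ} {f : Set.Icc c d → ℝ} :
    SegContDiff n f ↔ ContDiffOn ℝ n (segExt f) (Set.Icc c d) := Iff.rfl

theorem SegContDiff.congr_ext {n : ℕ} {f : Set.Icc c d → ℝ} {g : ℝ → ℝ}
    (hg : ContDiffOn ℝ n g (Set.Icc c d)) (h : ∀ t : Set.Icc c d, f t = g t) : SegContDiff n f :=
  hg.congr fun t ht => by
    change segExt f t = g t
    rw [segExt_of_mem f ht, h]

theorem SegContDiff.of_le {m n : ℕ} {f : Set.Icc c d → ℝ} (h : SegContDiff n f) (hmn : m ≤ n) :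
    SegContDiff m f := ContDiffOn.of_le h (by exact_mod_cast hmn)

theorem segContDiff_const (n : ℕ) (a : ℝ) : SegContDiff n (fun _ : Set.Icc c d => a) :=
  SegContDiff.congr_ext (g := fun _ => a) contDiffOn_const fun _ => rfl

theorem SegContDiff.add {n : ℕ} {f g : Set.Icc c d → ℝ} (hf : SegContDiff n f)
    (hg : SegContDiff n g) : SegContDiff n (f + g) :=
  SegContDiff.congr_ext (ContDiffOn.add (segContDiff_iff.1 hf) (segContDiff_iff.1 hg)) fun t => by
    simp [segExt_coe]

theorem SegContDiff.mul {n : ℕ} {f g : Set.Icc c d → ℝ} (hf : SegContDiff n f)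
    (hg : SegContDiff n g) : SegContDiff n (f * g) :=
  SegContDiff.congr_ext (ContDiffOn.mul (segContDiff_iff.1 hf) (segContDiff_iff.1 hg)) fun t => by
    simp [segExt_coe]

theorem SegContDiff.div {n : ℕ} {f g : Set.Icc c d → ℝ} (hf : SegContDiff n f)
    (hg : SegContDiff n g) (h0 : ∀ t, g t ≠ 0) : SegContDiff n (f / g) :=
  SegContDiff.congr_ext (ContDiffOn.div (segContDiff_iff.1 hf) (segContDiff_iff.1 hg)
    fun t ht => by rw [segExt_of_mem g ht]; exact h0 _) fun t => by
    simp [segExt_coe]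

theorem SegContDiff.smul {n : ℕ} {f : Set.Icc c d → ℝ} (hf : SegContDiff n f) (a : ℝ) :
    SegContDiff n (a • f) := (segContDiff_const n a).mul hf

theorem SegContDiff.sum {ι : Type*} {n : ℕ} {s : Finset ι} {f : ι → Set.Icc c d → ℝ}
    (hf : ∀ q ∈ s, SegContDiff n (f q)) : SegContDiff n (∑ q ∈ s, f q) := by
  classical
  induction s using Finset.induction_on with
  | empty => exact segContDiff_const n 0
  | insert q s hq ih =>
    rw [Finset.sum_insert hq]
    exact (hf q (by simp)).add (ih fun p hp => hf p (by simp [hp]))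

theorem SegContDiff.continuous {n : ℕ} {f : Set.Icc c d → ℝ} (hf : SegContDiff n f) :
    Continuous f := by
  have := continuousOn_iff_continuous_domRestrict.1 (ContDiffOn.continuousOn hf)
  convert this using 1
  funext t
  exact (segExt_coe f t).symm

theorem SegContDiff.hasDerivWithinAt {f : Set.Icc c d → ℝ} (hf : SegContDiff 1 f)
    (t : Set.Icc c d) : HasDerivWithinAt (segExt f) (segDeriv f t) (Set.Icc c d) t :=
  ((ContDiffOn.differentiableOn hf (by norm_num)) t t.2).hasDerivWithinAt

theorem SegContDiff.hasDerivAt {f : Set.Icc c d → ℝ} (hf : SegContDiff 1 f)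
    (t : Set.Icc c d) (h1 : c < t) (h2 : t < d) : HasDerivAt (segExt f) (segDeriv f t) t :=
  (hf.hasDerivWithinAt t).hasDerivAt (Icc_mem_nhds h1 h2)

theorem segDeriv_eq (hcd : c < d) {f : Set.Icc c d → ℝ} {t : Set.Icc c d} {g : ℝ → ℝ} {y : ℝ}
    (hg : HasDerivWithinAt g y (Set.Icc c d) t) (h : ∀ s : Set.Icc c d, f s = g s) :
    segDeriv f t = y := by
  have : HasDerivWithinAt (segExt f) y (Set.Icc c d) t :=
    hg.congr (fun s hs => by rw [segExt_of_mem f hs, h]) (by rw [segExt_coe f t, h])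
  exact this.derivWithin (uniqueDiffOn_Icc hcd t t.2)

theorem segDeriv_const (hcd : c < d) (a : ℝ) : segDeriv (fun _ : Set.Icc c d => a) = 0 := by
  funext t
  exact segDeriv_eq hcd (hasDerivWithinAt_const _ _ a) fun _ => rfl

theorem segDeriv_add (hcd : c < d) {f g : Set.Icc c d → ℝ} (hf : SegContDiff 1 f)
    (hg : SegContDiff 1 g) : segDeriv (f + g) = segDeriv f + segDeriv g := by
  funext t
  exact segDeriv_eq hcd ((hf.hasDerivWithinAt t).add (hg.hasDerivWithinAt t)) fun s => by
    simp [segExt_coe]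

theorem segDeriv_smul (hcd : c < d) {f : Set.Icc c d → ℝ} (hf : SegContDiff 1 f) (a : ℝ) :
    segDeriv (a • f) = a • segDeriv f := by
  funext t
  exact segDeriv_eq hcd ((hf.hasDerivWithinAt t).const_mul a) fun s => by
    simp [segExt_coe]

theorem SegContDiff.segDeriv (hcd : c < d) {n : ℕ} {f : Set.Icc c d → ℝ}
    (hf : SegContDiff (n + 1) f) : SegContDiff n (segDeriv f) := by
  have h : ContDiffOn ℝ ((n : WithTop ℕ∞) + 1) (segExt f) (Set.Icc c d) := by exact_mod_cast hf
  exact SegContDiff.congr_ext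
    ((contDiffOn_succ_iff_derivWithin (uniqueDiffOn_Icc hcd)).1 h).2.2 fun _ => rfl

theorem SegContDiff.iterate (hcd : c < d) {n r : ℕ} {f : Set.Icc c d → ℝ}
    (hf : SegContDiff (n + r) f) : SegContDiff n (PCSpline.segDeriv^[r] f) := by
  induction r generalizing f with
  | zero => exact hf
  | succ r ih => exact ih (SegContDiff.segDeriv hcd hf)

theorem SegContDiff.continuous_iterate (hcd : c < d) {n r : ℕ} {f : Set.Icc c d → ℝ}
    (hf : SegContDiff n f) (hr : r ≤ n) : Continuous (PCSpline.segDeriv^[r] f) :=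
  (SegContDiff.iterate (n := 0) hcd (hf.of_le (by omega : 0 + r ≤ n))).continuous

theorem segDeriv_iterate_add (hcd : c < d) {r : ℕ} {f g : Set.Icc c d → ℝ} (hf : SegContDiff r f)
    (hg : SegContDiff r g) : segDeriv^[r] (f + g) = segDeriv^[r] f + segDeriv^[r] g := by
  induction r generalizing f g with
  | zero => rfl
  | succ r ih =>
    simp only [Function.iterate_succ_apply]
    rw [segDeriv_add hcd (hf.of_le (by omega)) (hg.of_le (by omega)),
      ih (hf.segDeriv hcd) (hg.segDeriv hcd)]

theorem segDeriv_iterate_smul (hcd : c < d) {r : ℕ} {f : Set.Icc c d → ℝ} (hf : SegContDiff r f)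
    (a : ℝ) : segDeriv^[r] (a • f) = a • segDeriv^[r] f := by
  induction r generalizing f with
  | zero => rfl
  | succ r ih =>
    simp only [Function.iterate_succ_apply]
    rw [segDeriv_smul hcd (hf.of_le (by omega)), ih (hf.segDeriv hcd)]

theorem segDeriv_iterate_zero (hcd : c < d) (r : ℕ) :
    segDeriv^[r] (0 : Set.Icc c d → ℝ) = 0 := by
  induction r with
  | zero => rfl
  | succ r ih =>
    rw [Function.iterate_succ_apply, show segDeriv (0 : Set.Icc c d → ℝ) = 0 from
      segDeriv_const hcd 0, ih]

theorem segDeriv_iterate_const (hcd : c < d) {r : ℕ} (hr : r ≠ 0) (a : ℝ) :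
    segDeriv^[r] (fun _ : Set.Icc c d => a) = 0 := by
  obtain ⟨r, rfl⟩ := Nat.exists_eq_succ_of_ne_zero hr
  rw [Function.iterate_succ_apply, segDeriv_const hcd, segDeriv_iterate_zero hcd]

theorem segDeriv_iterate_sum (hcd : c < d) {ι : Type*} {r : ℕ} {s : Finset ι}
    {f : ι → Set.Icc c d → ℝ} (hf : ∀ q ∈ s, SegContDiff r (f q)) :
    segDeriv^[r] (∑ q ∈ s, f q) = ∑ q ∈ s, segDeriv^[r] (f q) := by
  classical
  induction s using Finset.induction_on with
  | empty => simpa using segDeriv_iterate_zero hcd r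
  | insert q s hq ih =>
    rw [Finset.sum_insert hq, Finset.sum_insert hq,
      segDeriv_iterate_add hcd (hf q (by simp)) (SegContDiff.sum fun p hp => hf p (by simp [hp])),
      ih fun p hp => hf p (by simp [hp])]

theorem segDeriv_iterate_sum_smul (hcd : c < d) {ι : Type*} {r : ℕ} {s : Finset ι}
    {f : ι → Set.Icc c d → ℝ} (hf : ∀ q ∈ s, SegContDiff r (f q)) (a : ι → ℝ)
    (t : Set.Icc c d) :
    segDeriv^[r] (∑ q ∈ s, a q • f q) t = ∑ q ∈ s, a q * segDeriv^[r] (f q) t := by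
  rw [segDeriv_iterate_sum hcd fun q hq => (hf q hq).smul (a q), Finset.sum_apply]
  refine Finset.sum_congr rfl fun q hq => ?_
  rw [segDeriv_iterate_smul hcd (hf q hq)]
  rfl

theorem segDeriv_iterate_eq (r : ℕ) (f : Set.Icc c d → ℝ) (t : Set.Icc c d) :
    segDeriv^[r] f t = iteratedDerivWithin r (segExt f) (Set.Icc c d) t := by
  induction r generalizing t with
  | zero => simp [segExt_coe]
  | succ r ih =>
    rw [Function.iterate_succ_apply', iteratedDerivWithin_succ]
    refine derivWithin_congr (fun s hs => ?_) ?_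
    · rw [← ih ⟨s, hs⟩]; exact segExt_of_mem _ hs
    · rw [← ih t]; exact segExt_coe _ t

/-- The Leibniz rule. -/
theorem segDeriv_iterate_mul (hcd : c < d) {r : ℕ} {f g : Set.Icc c d → ℝ}
    (hf : SegContDiff r f) (hg : SegContDiff r g) (t : Set.Icc c d) :
    segDeriv^[r] (f * g) t = ∑ q ∈ Finset.range (r + 1),
      (r.choose q : ℝ) * segDeriv^[r - q] f t * segDeriv^[q] g t := by
  have hfg : Set.EqOn (segExt (g * f)) (segExt g * segExt f) (Set.Icc c d) := fun s hs => by
    simp [segExt_of_mem _ hs]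
  rw [mul_comm f g, segDeriv_iterate_eq, iteratedDerivWithin_congr hfg t.2,
    iteratedDerivWithin_mul t.2 (uniqueDiffOn_Icc hcd) (segContDiff_iff.1 hg t t.2)
      (segContDiff_iff.1 hf t t.2)]
  refine Finset.sum_congr rfl fun q _ => ?_
  rw [segDeriv_iterate_eq, segDeriv_iterate_eq]
  ring

theorem segDeriv_iterate_mul_of_vanish (hcd : c < d) {r : ℕ} {f g : Set.Icc c d → ℝ}
    (hf : SegContDiff r f) (hg : SegContDiff r g) {t : Set.Icc c d}
    (h : ∀ s < r, segDeriv^[s] g t = 0) :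
    segDeriv^[r] (f * g) t = f t * segDeriv^[r] g t := by
  rw [segDeriv_iterate_mul hcd hf hg, Finset.sum_range_succ, Finset.sum_eq_zero]
  · simp
  · intro q hq
    rw [h q (Finset.mem_range.1 hq), mul_zero]

/-- By Leibniz, the first nonvanishing derivative of the product is `f t` times that of `g`; a
nonvanishing factor does not change the order of a zero. Only orders below `r` are differentiated,
hence `r ≤ n + 1`. -/
theorem vanish_mul_iff (hcd : c < d) {r n : ℕ} {f g : Set.Icc c d → ℝ}
    (hf : SegContDiff n f) (hg : SegContDiff n g) {t : Set.Icc c d} (hr : r ≤ n + 1)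
    (h0 : f t ≠ 0) :
    (∀ s < r, segDeriv^[s] (f * g) t = 0) ↔ ∀ s < r, segDeriv^[s] g t = 0 := by
  constructor
  · intro h s
    induction s using Nat.strong_induction_on with
    | _ s ih =>
      intro hs
      have := segDeriv_iterate_mul_of_vanish hcd (r := s) (hf.of_le (by omega))
        (hg.of_le (by omega)) (t := t) fun q hq => ih q hq (by omega)
      rw [h s hs] at this
      exact (mul_eq_zero.1 this.symm).resolve_left h0
  · intro h s hs
    rw [segDeriv_iterate_mul_of_vanish hcd (hf.of_le (by omega)) (hg.of_le (by omega))
      fun q hq => h q (by omega), h s hs, mul_zero]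

theorem eq_of_segDeriv_eq_zero {f : Set.Icc c d → ℝ} (hf : SegContDiff 1 f)
    (h : ∀ t, segDeriv f t = 0) (s t : Set.Icc c d) : f s = f t := by
  have key : ∀ s : Set.Icc c d, f s = segExt f c := fun s => by
    rw [← segExt_coe f s]
    exact constant_of_derivWithin_zero (ContDiffOn.differentiableOn hf (by norm_num))
      (fun x hx => h ⟨x, Set.Ico_subset_Icc_self hx⟩) s s.2
  rw [key s, key t]

theorem lt_of_segDeriv_pos {f : Set.Icc c d → ℝ} (hf : SegContDiff 1 f)
    {s t : Set.Icc c d} (hst : s < t)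
    (h : ∀ x : Set.Icc c d, s < x → x < t → 0 < segDeriv f x) : f s < f t := by
  have hsub : Set.Icc (s : ℝ) t ⊆ Set.Icc c d := Set.Icc_subset_Icc s.2.1 t.2.2
  have := strictMonoOn_of_deriv_pos (convex_Icc (s : ℝ) t) (f := segExt f)
    ((ContDiffOn.continuousOn hf).mono hsub) (fun x hx => by
      rw [interior_Icc] at hx
      have hx' : x ∈ Set.Icc c d := hsub ⟨hx.1.le, hx.2.le⟩
      rw [(hf.hasDerivAt ⟨x, hx'⟩ (s.2.1.trans_lt hx.1) (hx.2.trans_le t.2.2)).deriv]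
      exact h _ hx.1 hx.2)
  have h2 := this (Set.left_mem_Icc.2 (le_of_lt (Subtype.coe_lt_coe.2 hst)))
    (Set.right_mem_Icc.2 (le_of_lt (Subtype.coe_lt_coe.2 hst))) (Subtype.coe_lt_coe.2 hst)
  rwa [segExt_coe, segExt_coe] at h2

/-- Zero counting controls Wronskians only inside (a, b); continuity carries the weak inequality to
the end points. -/
theorem nonneg_of_nonneg_interior (hcd : c < d) {f : Set.Icc c d → ℝ} (hf : Continuous f)
    (h : ∀ t : Set.Icc c d, c < t → t < d → 0 ≤ f t) (t : Set.Icc c d) : 0 ≤ f t := by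
  have hg : ContinuousOn (segExt f) (Set.Icc c d) := by
    rw [continuousOn_iff_continuous_domRestrict]
    convert hf using 1
    funext t
    exact segExt_coe f t
  have hclos : closure (Set.Ioo c d) = Set.Icc c d := closure_Ioo hcd.ne
  have := ContinuousOn.image_closure (s := Set.Ioo c d) (f := segExt f) (by rwa [hclos])
  have h2 : segExt f t ∈ closure (segExt f '' Set.Ioo c d) :=
    this ⟨t, by rw [hclos]; exact t.2, rfl⟩
  have h3 : closure (segExt f '' Set.Ioo c d) ⊆ Set.Ici 0 := by
    refine closure_minimal ?_ isClosed_Ici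
    rintro _ ⟨x, hx, rfl⟩
    rw [segExt_of_mem f ⟨hx.1.le, hx.2.le⟩]
    exact h _ hx.1 hx.2
  simpa [segExt_coe] using h3 h2

end Segment

end PCSpline

namespace PCSpline

/-! ### Initial minors, Fekete's criterion and determinants of tail sums -/

section Minors

/-- The minor of the first `r` rows and the columns `J 0, ..., J (r - 1)`, where `v h a` is the
entry in row `a` and column `h`. -/
noncomputable def initialMinor (v : ℕ → ℕ → ℝ) {r : ℕ} (J : Fin r → ℕ) : ℝ :=
  Matrix.det (Matrix.of fun a q : Fin r => v (J q) a)

/-- Laplace expansion along the inserted column: the dependence on that column is one linear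
functional, the same for every position `j` up to sign. -/
theorem initialMinor_insertNth (v : ℕ → ℕ → ℝ) {s : ℕ} (j : Fin (s + 1)) (x : ℕ)
    (L : Fin s → ℕ) :
    initialMinor v (j.insertNth (α := fun _ => ℕ) x L) = (-1) ^ (j : ℕ) *
      ∑ a : Fin (s + 1), (-1) ^ (a : ℕ) * v x a *
        Matrix.det (Matrix.of fun b q : Fin s => v (L q) (a.succAbove b)) := by
  rw [initialMinor, Matrix.det_succ_column _ j, Finset.mul_sum]
  refine Finset.sum_congr rfl fun a _ => ?_
  have : (Matrix.of fun a q : Fin (s + 1) =>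
      v (j.insertNth (α := fun _ => ℕ) x L q) a).submatrix a.succAbove j.succAbove =
      Matrix.of fun b q : Fin s => v (L q) (a.succAbove b) := by
    ext b q
    simp
  rw [this, Matrix.of_apply, Fin.insertNth_apply_same]
  ring

theorem sum_initialMinor_eq_zero (v : ℕ → ℕ → ℝ) {s : ℕ} (K : Fin (s + 1) → ℕ) {a : ℕ}
    (ha : a < s) :
    ∑ i : Fin (s + 1), (-1) ^ (i : ℕ) * v (K i) a * initialMinor v (K ∘ i.succAbove) = 0 := by
  let M : Matrix (Fin (s + 1)) (Fin (s + 1)) ℝ :=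
    -- Row `a` is repeated on top, so the determinant is zero; its expansion along the top row is
    -- the claim.
    Matrix.of (Fin.cons (fun i => v (K i) a) fun b i => v (K i) b)
  have h0 : M.det = 0 :=
    Matrix.det_zero_of_row_eq (i := 0) (j := Fin.succ ⟨a, ha⟩) (Fin.succ_ne_zero _).symm (by
      funext i; rfl)
  rw [Matrix.det_succ_row_zero] at h0
  rw [← h0]
  refine Finset.sum_congr rfl fun i _ => ?_
  have : M.submatrix Fin.succ i.succAbove =
      Matrix.of fun b q : Fin s => v ((K ∘ i.succAbove) q) b := by
    ext b q
    simp [M]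
  rw [this]
  simp [M, initialMinor]

/-- A three-term relation between initial minors. -/
theorem initialMinor_three_term (v : ℕ → ℕ → ℝ) {s : ℕ} (K : Fin (s + 3) → ℕ)
    (q : Fin (s + 1)) :
    initialMinor v (K ∘ q.castSucc.succ.succAbove) *
        initialMinor v (fun p : Fin (s + 1) => K p.castSucc.succ) =
      initialMinor v (K ∘ (0 : Fin (s + 3)).succAbove) *
        initialMinor v ((0 : Fin (s + 1)).insertNth (α := fun _ => ℕ) (K 0)
          fun p : Fin s => K (q.succAbove p).castSucc.succ) +
      initialMinor v (K ∘ (Fin.last (s + 2)).succAbove) *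
        initialMinor v ((Fin.last s).insertNth (α := fun _ => ℕ) (K (Fin.last (s + 2)))
          fun p : Fin s => K (q.succAbove p).castSucc.succ) := by
  set L : Fin s → ℕ := fun p => K (q.succAbove p).castSucc.succ with hL
  -- The minor as a linear functional of one free column, the columns `L` being fixed; it vanishes
  -- on the columns of `L`.
  set ψ : ℕ → ℝ := fun x => ∑ a : Fin (s + 1), (-1) ^ (a : ℕ) * v x a *
        Matrix.det (Matrix.of fun b q : Fin s => v (L q) (a.succAbove b)) with hψ
  have hins : ∀ (j : Fin (s + 1)) (x : ℕ), initialMinor v (j.insertNth (α := fun _ => ℕ) x L) =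
      (-1) ^ (j : ℕ) * ψ x := fun j x => initialMinor_insertNth v j x L
  have hC : (fun p : Fin (s + 1) => K p.castSucc.succ) =
      q.insertNth (α := fun _ => ℕ) (K q.castSucc.succ) L := by
    rw [Fin.eq_insertNth_iff]
    exact ⟨rfl, rfl⟩
  have hzero : ∀ p : Fin (s + 1), p ≠ q → ψ (K p.castSucc.succ) = 0 := by
    intro p hp
    obtain ⟨p', rfl⟩ := Fin.exists_succAbove_eq hp
    have h1 := hins q (K (q.succAbove p').castSucc.succ)
    have h2 : initialMinor v (q.insertNth (α := fun _ => ℕ)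
        (K (q.succAbove p').castSucc.succ) L) = 0 := by
      refine Matrix.det_zero_of_column_eq (Fin.succAbove_ne q p').symm fun a => ?_
      simp [hL]
    rw [h2] at h1
    rcases mul_eq_zero.1 h1.symm with h | h
    · exact absurd h (pow_ne_zero _ (by norm_num))
    · exact h
  -- Applying the functional to the linear relation between the columns `K i`; only the two extreme
  -- columns and the one omitted from `L` survive.
  have hrel : ∑ i : Fin (s + 3), (-1) ^ (i : ℕ) * initialMinor v (K ∘ i.succAbove) * ψ (K i) =
      0 := by
    simp only [hψ, Finset.mul_sum]
    rw [Finset.sum_comm]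
    refine Finset.sum_eq_zero fun a _ => ?_
    have := sum_initialMinor_eq_zero v K (a := a) (by omega)
    calc _ = (-1) ^ (a : ℕ) * Matrix.det (Matrix.of fun b q : Fin s => v (L q) (a.succAbove b)) *
          ∑ i : Fin (s + 3), (-1) ^ (i : ℕ) * v (K i) a * initialMinor v (K ∘ i.succAbove) := by
          rw [Finset.mul_sum]
          exact Finset.sum_congr rfl fun i _ => by ring
      _ = 0 := by rw [this, mul_zero]
  rw [Fin.sum_univ_succ, Fin.sum_univ_castSucc,
    Finset.sum_eq_single q (fun p _ hp => by rw [hzero p hp, mul_zero]) (by simp)] at hrel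
  rw [hC, hins, hins, hins]
  have hsq : ∀ n : ℕ, ((-1 : ℝ) ^ n) * (-1) ^ n = 1 := fun n => by
    rw [← mul_pow]; norm_num
  simp only [Fin.succ_last, Fin.val_zero, pow_zero, one_mul, Fin.val_succ, Fin.val_castSucc,
    Fin.val_last, pow_succ] at hrel ⊢
  linear_combination -hrel

theorem initialMinor_consecutive_of_gapless {s : ℕ} {J : Fin (s + 1) → ℕ}
    (h : ∀ q : Fin s, J q.succ = J q.castSucc + 1) : J = fun q : Fin (s + 1) => J 0 + (q : ℕ) := by
  funext q
  induction q using Fin.induction with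
  | zero => simp
  | succ q ih =>
    rw [h, ih]
    simp only [Fin.val_castSucc, Fin.val_succ]
    ring

/-- Fekete's criterion: if all initial minors with consecutive columns are positive, then all
initial minors are positive. -/
theorem initialMinor_pos_of_consecutive (v : ℕ → ℕ → ℝ) (lo hi : ℕ)
    (hcons : ∀ r p, lo ≤ p → p + r ≤ hi + 1 → 0 < initialMinor v fun q : Fin r => p + (q : ℕ)) :
    ∀ (r : ℕ) (J : Fin r → ℕ), StrictMono J → (∀ q, lo ≤ J q ∧ J q ≤ hi) →
      0 < initialMinor v J := by
  have hgapless : ∀ (s : ℕ) (J : Fin (s + 1) → ℕ), (∀ q, lo ≤ J q ∧ J q ≤ hi) →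
      (∀ q : Fin s, J q.succ = J q.castSucc + 1) → 0 < initialMinor v J := by
    intro s J hJ h
    have hJ' := initialMinor_consecutive_of_gapless h
    have hl : J 0 + s ≤ hi := by
      have := (hJ (Fin.last s)).2
      rwa [hJ'] at this
    rw [hJ']
    exact hcons _ _ (hJ 0).1 (by omega)
  intro r
  induction r with
  | zero =>
    intro J _ _
    simp [initialMinor]
  | succ r ihr =>
    cases r with
    | zero => exact fun J _ hJ => hgapless 0 J hJ fun q => q.elim0
    | succ s =>
      intro J
      -- For fixed size, induction on the spread of the columns. Filling a gap of `J` by one index,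
      -- the three-term relation writes the minor of `J` times a smaller minor as a sum of products
      -- of smaller minors and minors of the same size with smaller spread.
      induction hd : J (Fin.last (s + 1)) - J 0 using Nat.strong_induction_on generalizing J with
      | _ d ih =>
      intro hmono hJ
      by_cases hgap : ∀ q : Fin (s + 1), J q.succ = J q.castSucc + 1
      · exact hgapless _ J hJ hgap
      push Not at hgap
      obtain ⟨q, hq⟩ := hgap
      have hlt : J q.castSucc + 1 < J q.succ := by
        have := hmono (Fin.castSucc_lt_succ (i := q))
        omega
      set K : Fin (s + 3) → ℕ :=
        q.castSucc.succ.insertNth (α := fun _ => ℕ) (J q.castSucc + 1) J with hKdef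
      have hK : StrictMono K := Fin.strictMono_insertNth hmono q _ (by omega) hlt
      have hKq : K q.castSucc.succ = J q.castSucc + 1 := Fin.insertNth_apply_same _ _ _
      have hKJ : K ∘ q.castSucc.succ.succAbove = J := by
        funext p
        exact Fin.insertNth_apply_succAbove _ _ _ _
      have hKmem : ∀ i, lo ≤ K i ∧ K i ≤ hi := by
        intro i
        rcases eq_or_ne i q.castSucc.succ with rfl | hi
        · rw [hKq]
          exact ⟨(hJ q.castSucc).1.trans (by omega), hlt.le.trans (hJ _).2⟩
        · obtain ⟨p, rfl⟩ := Fin.exists_succAbove_eq hi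
          rw [← Function.comp_apply (f := K), hKJ]
          exact hJ p
      have hK0 : K 0 = J 0 := by
        rw [← hKJ, Function.comp_apply, Fin.succAbove_ne_zero_zero (Fin.succ_ne_zero _)]
      have hKl : K (Fin.last (s + 2)) = J (Fin.last (s + 1)) := by
        rw [← hKJ, Function.comp_apply, Fin.succAbove_ne_last_last]
        intro h
        have := congrArg Fin.val h
        simp only [Fin.val_succ, Fin.val_castSucc, Fin.val_last] at this
        omega
      have h3 := initialMinor_three_term v K q
      rw [hKJ] at h3
      have hm2 : 0 < initialMinor v fun p : Fin (s + 1) => K p.castSucc.succ :=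
        ihr _ (fun a b hab => hK (by simpa using hab)) fun p => hKmem _
      have hL : StrictMono fun p : Fin s => K (q.succAbove p).castSucc.succ :=
        fun a b hab => hK (by simpa using hab)
      have hm1 : 0 < initialMinor v ((0 : Fin (s + 1)).insertNth (α := fun _ => ℕ) (K 0)
          fun p : Fin s => K (q.succAbove p).castSucc.succ) := by
        refine ihr _ ?_ ?_
        · rw [Fin.strictMono_insertNth_iff]
          exact ⟨hL, fun i hi => absurd hi (by simp), fun i _ => hK (Fin.succ_pos _)⟩
        · intro p
          refine Fin.succAboveCases (0 : Fin (s + 1)) ?_ (fun p => ?_) p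
          · simpa using hKmem 0
          · simpa using hKmem _
      have hm3 : 0 < initialMinor v ((Fin.last s).insertNth (α := fun _ => ℕ)
          (K (Fin.last (s + 2))) fun p : Fin s => K (q.succAbove p).castSucc.succ) := by
        refine ihr _ ?_ ?_
        · rw [Fin.strictMono_insertNth_iff]
          refine ⟨hL, fun i hi => hK ?_, fun i hi => absurd hi (by simp)⟩
          rw [Fin.lt_def]
          simp only [Fin.val_succ, Fin.val_castSucc, Fin.val_last]
          omega
        · intro p
          refine Fin.succAboveCases (Fin.last s) ?_ (fun p => ?_) p
          · rw [Fin.insertNth_apply_same]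
            exact hKmem _
          · rw [Fin.insertNth_apply_succAbove]
            exact hKmem _
      have hD0 : 0 < initialMinor v (K ∘ (0 : Fin (s + 3)).succAbove) := by
        refine ih _ ?_ _ rfl (hK.comp (Fin.strictMono_succAbove _)) fun p => hKmem _
        have h1 : K 0 < K (Fin.succ 0) := hK (Fin.succ_pos _)
        have h2 : K (Fin.succ 0) ≤ J (Fin.last (s + 1)) := hKl ▸ hK.monotone (Fin.le_last _)
        have h4 : K (Fin.last (s + 1)).succ = J (Fin.last (s + 1)) := hKl
        simp only [Function.comp_apply, Fin.zero_succAbove, h4]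
        omega
      have hDl : 0 < initialMinor v (K ∘ (Fin.last (s + 2)).succAbove) := by
        refine ih _ ?_ _ rfl (hK.comp (Fin.strictMono_succAbove _)) fun p => hKmem _
        have h1 : K (Fin.castSucc (Fin.last (s + 1))) < J (Fin.last (s + 1)) :=
          hKl ▸ hK (Fin.castSucc_lt_last _)
        have h2 : K 0 ≤ K (Fin.castSucc (Fin.last (s + 1))) := hK.monotone (Fin.zero_le _)
        have h4 : K (Fin.castSucc 0) = J 0 := hK0
        simp only [Function.comp_apply, Fin.succAbove_last, h4]
        omega
      have : 0 < initialMinor v J * initialMinor v fun p : Fin (s + 1) => K p.castSucc.succ := by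
        rw [h3]
        positivity
      exact (pos_iff_pos_of_mul_pos this).2 hm2

/-- The column index that follows `K q`, the last one being followed by `N`. -/
def nextIndex {s : ℕ} (K : Fin (s + 1) → ℕ) (N : ℕ) : Fin (s + 1) → ℕ :=
  Fin.snoc (α := fun _ => ℕ) (fun q : Fin s => K q.succ) N

/-- Subtracting from each column its successor leaves sums over disjoint consecutive blocks, and
multilinearity expands these. -/
theorem det_tail_sums (v : ℕ → ℕ → ℝ) {s : ℕ} {K : Fin (s + 1) → ℕ} (hK : StrictMono K) {N : ℕ}
    (hN : ∀ q, K q ≤ N) :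
    Matrix.det (Matrix.of fun a q : Fin (s + 1) => ∑ h ∈ Finset.Ioc (K q) N, v h a) =
      ∑ p ∈ Fintype.piFinset fun q => Finset.Ioc (K q) (nextIndex K N q), initialMinor v p := by
  have h1 : Matrix.det (Matrix.of fun a q : Fin (s + 1) => ∑ h ∈ Finset.Ioc (K q) N, v h a) =
      Matrix.det (Matrix.of fun a q : Fin (s + 1) =>
        ∑ h ∈ Finset.Ioc (K q) (nextIndex K N q), v h a) := by
    -- Reversing the order turns the successor column into the predecessor that the column-operation
    -- lemma expects.
    rw [← Matrix.det_submatrix_equiv_self Fin.revPerm, eq_comm,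
      ← Matrix.det_submatrix_equiv_self Fin.revPerm, eq_comm]
    refine Matrix.det_eq_of_forall_col_eq_smul_add_pred (fun _ => 1) (fun a => ?_) fun a q => ?_
    · simp [nextIndex]
    · simp only [Matrix.submatrix_apply, Fin.revPerm_apply, Matrix.of_apply, one_mul,
        Fin.rev_succ, Fin.rev_castSucc, nextIndex, Fin.snoc_castSucc]
      rw [← Finset.sum_union (Finset.disjoint_left.2 fun x hx hy => by
        rw [Finset.mem_Ioc] at hx hy; omega), Finset.Ioc_union_Ioc_eq_Ioc
          (hK (Fin.castSucc_lt_succ)).le (hN _)]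
  rw [h1, ← Matrix.det_transpose]
  have h2 : (Matrix.of fun a q : Fin (s + 1) =>
      ∑ h ∈ Finset.Ioc (K q) (nextIndex K N q), v h a).transpose =
      fun q => ∑ h ∈ Finset.Ioc (K q) (nextIndex K N q), fun a : Fin (s + 1) => v h a := by
    ext q a
    simp [Matrix.transpose_apply, Finset.sum_apply]
  rw [h2]
  have h3 := (Matrix.detRowAlternating (R := ℝ) (n := Fin (s + 1))).toMultilinearMap.map_sum_finset
    (fun (_ : Fin (s + 1)) (h : ℕ) (a : Fin (s + 1)) => v h a)
    (fun q => Finset.Ioc (K q) (nextIndex K N q))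
  refine h3.trans (Finset.sum_congr rfl fun p _ => ?_)
  rw [initialMinor, ← Matrix.det_transpose]
  rfl

theorem strictMono_of_mem_blocks {s : ℕ} {K : Fin (s + 1) → ℕ} {N : ℕ} {p : Fin (s + 1) → ℕ}
    (hp : p ∈ Fintype.piFinset fun q => Finset.Ioc (K q) (nextIndex K N q)) : StrictMono p := by
  rw [Fintype.mem_piFinset] at hp
  rw [Fin.strictMono_iff_lt_succ]
  intro q
  have h1 := Finset.mem_Ioc.1 (hp q.castSucc)
  have h2 := Finset.mem_Ioc.1 (hp q.succ)
  rw [nextIndex, Fin.snoc_castSucc] at h1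
  omega

theorem nextIndex_le {s : ℕ} {K : Fin (s + 1) → ℕ} {N : ℕ} (h : ∀ q, K q ≤ N)
    (q : Fin (s + 1)) : nextIndex K N q ≤ N := by
  refine Fin.lastCases ?_ (fun q => ?_) q
  · simp [nextIndex]
  · simpa [nextIndex] using h q.succ

theorem lt_nextIndex {s : ℕ} {K : Fin (s + 1) → ℕ} (hK : StrictMono K) {N : ℕ}
    (h : ∀ q, K q < N) (q : Fin (s + 1)) : K q < nextIndex K N q := by
  refine Fin.lastCases ?_ (fun q => ?_) q
  · simpa [nextIndex] using h _
  · simpa [nextIndex] using hK q.castSucc_lt_succ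

theorem card_le_of_strictMono {r : ℕ} {J : Fin r → ℕ} (hJ : StrictMono J) {lo hi : ℕ}
    (h : ∀ q, lo ≤ J q ∧ J q ≤ hi) : r ≤ hi + 1 - lo := by
  have h1 : (Finset.univ.image J).card ≤ (Finset.Icc lo hi).card :=
    Finset.card_le_card fun x hx => by
      obtain ⟨q, -, rfl⟩ := Finset.mem_image.1 hx
      exact Finset.mem_Icc.2 (h q)
  rwa [Finset.card_image_of_injective _ hJ.injective, Finset.card_fin, Nat.card_Icc] at h1

end Minors

end PCSpline

namespace PCSpline

/-! ### Wronskians and their sign near a left end point -/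

section Wronskian

open Filter Topology

variable {c d : ℝ} {r : ℕ}

/-- The Wronskian of `g 0, ..., g (r - 1)` at `t`. -/
noncomputable def segWr (g : Fin r → Set.Icc c d → ℝ) (t : Set.Icc c d) : ℝ :=
  Matrix.det (Matrix.of fun a q : Fin r => segDeriv^[(a : ℕ)] (g q) t)

theorem continuous_segWr (hcd : c < d) {g : Fin r → Set.Icc c d → ℝ}
    (hg : ∀ q, SegContDiff (r - 1) (g q)) : Continuous (segWr g) :=
  Continuous.matrix_det (continuous_matrix fun a q =>
    (hg q).continuous_iterate hcd (by omega))

/-- The Leibniz rule factors the matrix of derivatives through a lower triangular matrix with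
diagonal entries `u t`. -/
theorem segWr_mul (hcd : c < d) {u : Set.Icc c d → ℝ} {g : Fin r → Set.Icc c d → ℝ}
    (hu : SegContDiff (r - 1) u) (hg : ∀ q, SegContDiff (r - 1) (g q)) (t : Set.Icc c d) :
    segWr (fun q => u * g q) t = u t ^ r * segWr g t := by
  let A : Matrix (Fin r) (Fin r) ℝ := Matrix.of fun a b =>
    ((a : ℕ).choose b : ℝ) * segDeriv^[(a : ℕ) - b] u t
  have hA : A.IsLowerTriangular := by
    intro a b hab
    have : (a : ℕ) < b := by simpa using hab
    simp [A, Nat.choose_eq_zero_of_lt this]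
  have hdet : A.det = u t ^ r := by
    rw [Matrix.det_of_isLowerTriangular A hA]
    simp [A]
  rw [segWr, segWr, ← hdet, ← Matrix.det_mul]
  congr 1
  ext a q
  rw [Matrix.of_apply, segDeriv_iterate_mul hcd (hu.of_le (by omega)) ((hg q).of_le (by omega)),
    Matrix.mul_apply]
  simp only [A, Matrix.of_apply]
  rw [Fin.sum_univ_eq_sum_range (n := r) (fun b =>
      ((a : ℕ).choose b : ℝ) * segDeriv^[(a : ℕ) - b] u t * segDeriv^[b] (g q) t)]
  refine Finset.sum_subset (fun b hb => ?_) fun b _ hb => ?_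
  · rw [Finset.mem_range] at hb ⊢
    omega
  · rw [Finset.mem_range] at hb
    rw [Nat.choose_eq_zero_of_lt (by omega)]
    simp

theorem segWr_cons_one (hcd : c < d) {g : Fin (r + 1) → Set.Icc c d → ℝ}
    (hg : g 0 = 1) (t : Set.Icc c d) :
    segWr g t = segWr (fun q : Fin r => segDeriv (g q.succ)) t := by
  rw [segWr, Matrix.det_succ_column_zero, Fin.sum_univ_succ, Finset.sum_eq_zero]
  · simp only [hg, segWr, Fin.val_zero, pow_zero, Matrix.of_apply, Function.iterate_zero, id,
      Pi.one_apply, one_mul, add_zero]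
    rfl
  · intro a _
    rw [Matrix.of_apply, hg, show (1 : Set.Icc c d → ℝ) = fun _ => 1 from rfl,
      segDeriv_iterate_const hcd (by simp)]
    simp

/-- A kernel vector of the singular Wronskian matrix is a combination with an `r`-fold zero at `t`,
the form in which zero bounds apply. -/
theorem exists_combination_of_segWr_eq_zero {g : Fin r → Set.Icc c d → ℝ} {t : Set.Icc c d}
    (h : segWr g t = 0) :
    ∃ x : Fin r → ℝ, x ≠ 0 ∧ ∀ a < r, ∑ q, x q * segDeriv^[a] (g q) t = 0 := by
  obtain ⟨x, hx, h⟩ := Matrix.exists_mulVec_eq_zero_iff.2 h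
  refine ⟨x, hx, fun a ha => ?_⟩
  have := congrFun h ⟨a, ha⟩
  simp only [Matrix.mulVec, dotProduct, Matrix.of_apply, Pi.zero_apply] at this
  rw [← this]
  exact Finset.sum_congr rfl fun q _ => mul_comm _ _

theorem eq_zero_of_segWr_ne_zero {g : Fin r → Set.Icc c d → ℝ} {t : Set.Icc c d}
    (h : segWr g t ≠ 0) {x : Fin r → ℝ} (hx : ∀ a < r, ∑ q, x q * segDeriv^[a] (g q) t = 0) :
    x = 0 := by
  refine Matrix.eq_zero_of_mulVec_eq_zero h ?_
  funext a
  rw [Pi.zero_apply, ← hx a a.2]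
  simp only [Matrix.mulVec, dotProduct, Matrix.of_apply]
  exact Finset.sum_congr rfl fun q _ => mul_comm _ _

theorem SegContDiff.tendsto_left (hcd : c < d) {n : ℕ} {f : Set.Icc c d → ℝ}
    (hf : SegContDiff n f) :
    Tendsto (segExt f) (𝓝[>] c) (𝓝 (f ⟨c, Set.left_mem_Icc.2 hcd.le⟩)) := by
  have h := (ContDiffOn.continuousOn hf) c (Set.left_mem_Icc.2 hcd.le)
  have h2 : Tendsto (segExt f) (𝓝[Set.Icc c d] c) (𝓝 (segExt f c)) := h
  rw [segExt_of_mem f (Set.left_mem_Icc.2 hcd.le)] at h2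
  refine h2.mono_left ?_
  rw [← nhdsWithin_Ioo_eq_nhdsGT hcd]
  exact nhdsWithin_mono _ Set.Ioo_subset_Icc_self

/-- The one-sided leading Taylor coefficient, by repeated use of L'Hôpital's rule; mere continuity
of the derivative of order `e` suffices. -/
theorem tendsto_div_pow_of_vanish (hcd : c < d) {e : ℕ} {f : Set.Icc c d → ℝ}
    (hf : SegContDiff e f)
    (h0 : ∀ s < e, segDeriv^[s] f ⟨c, Set.left_mem_Icc.2 hcd.le⟩ = 0) :
    Tendsto (fun x => segExt f x / (x - c) ^ e) (𝓝[>] c)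
      (𝓝 (segDeriv^[e] f ⟨c, Set.left_mem_Icc.2 hcd.le⟩ / (e.factorial : ℝ))) := by
  induction e generalizing f with
  | zero => simpa using hf.tendsto_left hcd
  | succ e ih =>
    have ih' := ih (hf.segDeriv hcd) fun s hs => h0 (s + 1) (by omega)
    have hf1 : SegContDiff 1 f := hf.of_le (by omega)
    refine HasDerivAt.lhopital_zero_right_on_Ioo (f' := segExt (segDeriv f))
      (g' := fun x => ((e + 1 : ℕ) : ℝ) * (x - c) ^ e) hcd ?_ ?_ ?_ ?_ ?_ ?_
    · intro x hx
      have hx' : x ∈ Set.Icc c d := ⟨hx.1.le, hx.2.le⟩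
      rw [segExt_of_mem _ hx']
      exact hf1.hasDerivAt ⟨x, hx'⟩ hx.1 hx.2
    · intro x _
      have h := ((hasDerivAt_id' x).sub_const c).fun_pow (e + 1)
      rwa [mul_one, Nat.add_sub_cancel] at h
    · intro x hx
      have : (0 : ℝ) < x - c := sub_pos.2 hx.1
      positivity
    · have h := hf.tendsto_left hcd
      rwa [show f ⟨c, Set.left_mem_Icc.2 hcd.le⟩ = 0 from h0 0 (by omega)] at h
    · have : Continuous fun x : ℝ => (x - c) ^ (e + 1) := by fun_prop
      have h := (this.tendsto c).mono_left (nhdsWithin_le_nhds (s := Set.Ioi c))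
      simpa using h
    · have h := ih'.div_const ((e + 1 : ℕ) : ℝ)
      rw [div_div, mul_comm ((e.factorial : ℕ) : ℝ), ← Nat.cast_mul, ← Nat.factorial_succ] at h
      refine h.congr fun x => ?_
      rw [div_div, mul_comm]

/-- If f behaves like β(x - c)^p / p!, its derivative of order a is governed by p(p-1)⋯(p-a+1). For
`a > p` this product is zero, and a spare positive power of x - c kills the bounded derivative. -/
theorem tendsto_scaled_segDeriv (hcd : c < d) {M p a : ℕ} {f : Set.Icc c d → ℝ}
    (hf : SegContDiff M f) (hp : p ≤ M) (ha : a ≤ M)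
    (h0 : ∀ s < p, segDeriv^[s] f ⟨c, Set.left_mem_Icc.2 hcd.le⟩ = 0) :
    Tendsto (fun x => (x - c) ^ a * (((x - c) ^ p)⁻¹ * segExt (segDeriv^[a] f) x)) (𝓝[>] c)
      (𝓝 (segDeriv^[p] f ⟨c, Set.left_mem_Icc.2 hcd.le⟩ / (p.factorial : ℝ) *
        (p.descFactorial a : ℝ))) := by
  rcases le_or_gt a p with hap | hap
  · obtain ⟨e, rfl⟩ := Nat.exists_eq_add_of_le hap
    have hg : SegContDiff e (segDeriv^[a] f) :=
      SegContDiff.iterate hcd (hf.of_le (by omega))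
    have hit : ∀ s, segDeriv^[s] (segDeriv^[a] f) = segDeriv^[a + s] f := fun s => by
      rw [add_comm, Function.iterate_add_apply]
    have h := tendsto_div_pow_of_vanish hcd hg fun s hs => by
      rw [hit]; exact h0 _ (by omega)
    rw [hit] at h
    have hfac : ((a + e).factorial : ℝ) = e.factorial * (a + e).descFactorial a := by
      rw [← Nat.factorial_mul_descFactorial hap, Nat.add_sub_cancel_left, Nat.cast_mul]
    have he : (e.factorial : ℝ) ≠ 0 := by positivity
    have hd : ((a + e).descFactorial a : ℝ) ≠ 0 := by
      have : 0 < (a + e).descFactorial a := Nat.pos_of_ne_zero fun h => by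
        rw [Nat.descFactorial_eq_zero_iff_lt] at h; omega
      positivity
    rw [hfac]
    have hlim : segDeriv^[a + e] f ⟨c, Set.left_mem_Icc.2 hcd.le⟩ /
        ((e.factorial : ℝ) * ((a + e).descFactorial a : ℝ)) * ((a + e).descFactorial a : ℝ) =
        segDeriv^[a + e] f ⟨c, Set.left_mem_Icc.2 hcd.le⟩ / (e.factorial : ℝ) := by
      field_simp
    rw [hlim]
    refine h.congr' ?_
    filter_upwards [self_mem_nhdsWithin] with x hx
    have : x - c ≠ 0 := (sub_pos.2 hx).ne'
    rw [pow_add]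
    field_simp
  · rw [Nat.descFactorial_eq_zero_iff_lt.2 hap, Nat.cast_zero, mul_zero]
    obtain ⟨e, rfl⟩ := Nat.exists_eq_add_of_lt hap
    have hg : SegContDiff 0 (segDeriv^[p + e + 1] f) :=
      SegContDiff.iterate hcd (hf.of_le (by omega))
    have hc : Continuous fun x : ℝ => (x - c) ^ (e + 1) := by fun_prop
    have h1 := (hc.tendsto c).mono_left (nhdsWithin_le_nhds (s := Set.Ioi c))
    have h2 := h1.mul (hg.tendsto_left hcd)
    simp only [sub_self, ne_eq, Nat.add_eq_zero_iff, one_ne_zero, and_false, not_false_eq_true,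
      zero_pow, zero_mul] at h2
    refine h2.congr' ?_
    filter_upwards [self_mem_nhdsWithin] with x hx
    have : x - c ≠ 0 := (sub_pos.2 hx).ne'
    rw [show (x - c) ^ (p + e + 1) = (x - c) ^ (e + 1) * (x - c) ^ p by ring]
    field_simp

/-- Descending factorials of length a are monic polynomials of degree a, so the determinant is a
Vandermonde determinant with increasing nodes. -/
theorem det_descFactorial_pos {p : Fin r → ℕ} (hp : StrictMono p) :
    0 < Matrix.det (Matrix.of fun a q : Fin r => ((p q).descFactorial a : ℝ)) := by
  have h := Matrix.det_eval_matrixOfPolynomials_eq_det_vandermonde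
    (fun i => (p i : ℝ)) (fun i : Fin r => descPochhammer ℝ i)
    (fun i => descPochhammer_natDegree ℝ i) (fun i => monic_descPochhammer ℝ i)
  rw [← Matrix.det_transpose]
  have h2 : (Matrix.of fun a q : Fin r => ((p q).descFactorial a : ℝ)).transpose =
      Matrix.of fun i j : Fin r => (descPochhammer ℝ j).eval (p i : ℝ) := by
    ext i j
    simp [descPochhammer_eval_eq_descFactorial]
  rw [h2, ← h, Matrix.det_vandermonde]
  refine Finset.prod_pos fun i _ => Finset.prod_pos fun j hj => sub_pos.2 ?_
  exact_mod_cast hp (Finset.mem_Ioi.1 hj)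

/-- The sign of a Wronskian close to a point where the functions have zeros of increasing
orders. -/
theorem exists_segWr_sign (hcd : c < d) {M : ℕ} (hr : r - 1 ≤ M) {g : Fin r → Set.Icc c d → ℝ}
    (hg : ∀ q, SegContDiff M (g q)) {p : Fin r → ℕ} (hp : StrictMono p) (hpM : ∀ q, p q ≤ M)
    (h0 : ∀ q, ∀ s < p q, segDeriv^[s] (g q) ⟨c, Set.left_mem_Icc.2 hcd.le⟩ = 0)
    (h1 : ∀ q, segDeriv^[p q] (g q) ⟨c, Set.left_mem_Icc.2 hcd.le⟩ ≠ 0) :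
    ∃ t : Set.Icc c d, c < t ∧ t < d ∧
      0 < (∏ q, segDeriv^[p q] (g q) ⟨c, Set.left_mem_Icc.2 hcd.le⟩) * segWr g t := by
  set β : Fin r → ℝ := fun q => segDeriv^[p q] (g q) ⟨c, Set.left_mem_Icc.2 hcd.le⟩ with hβ
  -- Scaling row `a` by (x - c)^a and column `q` by (x - c)^(-p q) keeps the sign of the determinant
  -- for x > c and makes the matrix converge.
  have hlim : Tendsto (fun x => Matrix.det (Matrix.of fun a q : Fin r =>
      (x - c) ^ (a : ℕ) * (((x - c) ^ p q)⁻¹ * segExt (segDeriv^[(a : ℕ)] (g q)) x))) (𝓝[>] c)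
      (𝓝 (Matrix.det (Matrix.of fun a q : Fin r =>
        β q / ((p q).factorial : ℝ) * ((p q).descFactorial a : ℝ)))) := by
    have hc : Continuous fun A : Matrix (Fin r) (Fin r) ℝ => A.det := continuous_id.matrix_det
    refine (hc.tendsto _).comp ?_
    refine tendsto_pi_nhds.2 fun a => tendsto_pi_nhds.2 fun q => ?_
    exact tendsto_scaled_segDeriv hcd (hg q) (hpM q) (by omega) (h0 q)
  have hβ0 : (∏ q, β q) ≠ 0 := Finset.prod_ne_zero_iff.2 fun q _ => h1 q
  -- The limit is the product of the `β q` times a positive number, so one more factor `∏ q, β q`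
  -- produces a square.
  have hpos : 0 < (∏ q, β q) * Matrix.det (Matrix.of fun a q : Fin r =>
        β q / ((p q).factorial : ℝ) * ((p q).descFactorial a : ℝ)) := by
    have := Matrix.det_mul_row (fun q => β q / ((p q).factorial : ℝ))
      (Matrix.of fun a q : Fin r => ((p q).descFactorial a : ℝ))
    simp only [Matrix.of_apply] at this
    rw [this, Finset.prod_div_distrib, ← mul_assoc, mul_div_assoc']
    refine mul_pos (div_pos (mul_self_pos.2 hβ0) ?_) (det_descFactorial_pos hp)
    exact Finset.prod_pos fun q _ => by positivity
  have hev := (hlim.const_mul (∏ q, β q)).eventually (lt_mem_nhds hpos)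
  have hIoo : ∀ᶠ x in 𝓝[>] c, x ∈ Set.Ioo c d := Ioo_mem_nhdsGT hcd
  obtain ⟨x, hx, hxm⟩ := (hev.and hIoo).exists
  have hx' : x ∈ Set.Icc c d := ⟨hxm.1.le, hxm.2.le⟩
  refine ⟨⟨x, hx'⟩, hxm.1, hxm.2, ?_⟩
  have e1 := Matrix.det_mul_column (fun a : Fin r => (x - c) ^ (a : ℕ))
    (Matrix.of fun a q : Fin r => ((x - c) ^ p q)⁻¹ * segExt (segDeriv^[(a : ℕ)] (g q)) x)
  have e2 := Matrix.det_mul_row (fun q : Fin r => ((x - c) ^ p q)⁻¹)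
    (Matrix.of fun a q : Fin r => segExt (segDeriv^[(a : ℕ)] (g q)) x)
  simp only [Matrix.of_apply] at e1 e2
  rw [e1, e2] at hx
  have e3 : segWr g ⟨x, hx'⟩ =
      Matrix.det (Matrix.of fun a q : Fin r => segExt (segDeriv^[(a : ℕ)] (g q)) x) := by
    rw [segWr]
    congr 1
    ext a q
    exact (segExt_of_mem _ hx').symm
  rw [e3]
  have hxc : 0 < x - c := sub_pos.2 hxm.1
  have hA : 0 < ∏ a : Fin r, (x - c) ^ (a : ℕ) := Finset.prod_pos fun _ _ => by positivity
  have hB : 0 < ∏ q : Fin r, ((x - c) ^ p q)⁻¹ := Finset.prod_pos fun _ _ => by positivity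
  have hAB := mul_pos hA hB
  refine (pos_iff_pos_of_mul_pos (a := (∏ a : Fin r, (x - c) ^ (a : ℕ)) *
    ∏ q : Fin r, ((x - c) ^ p q)⁻¹) ?_).1 hAB
  convert hx using 1
  ring

end Wronskian

end PCSpline

namespace PCSpline

/-! ### Zeros, signs and Rolle's theorem for piecewise functions -/

section Piecewise

variable {k : ℕ} {X : Knots k}

theorem Knots.seg_lt (X : Knots k) (i : Fin (k + 1)) : X.pt i.castSucc < X.pt i.succ :=
  X.strictMono i.castSucc_lt_succ

theorem Knots.exists_seg (X : Knots k) {t : ℝ}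
    (ht : t ∈ Set.Icc (X.pt 0) (X.pt (Fin.last (k + 1)))) :
    ∃ i : Fin (k + 1), t ∈ Set.Icc (X.pt i.castSucc) (X.pt i.succ) := by
  have key : ∀ j : Fin (k + 1), t ≤ X.pt j.succ →
      ∃ i : Fin (k + 1), t ∈ Set.Icc (X.pt i.castSucc) (X.pt i.succ) := by
    intro j
    induction j using Fin.induction with
    | zero => exact fun h => ⟨0, ht.1, h⟩
    | succ j ih =>
      intro h
      rcases le_total t (X.pt j.castSucc.succ) with h' | h'
      · exact ih h'
      · exact ⟨j.succ, h', h⟩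
  exact key (Fin.last k) ht.2

theorem Knots.mem_range (X : Knots k) {i : Fin (k + 1)} (t : X.Seg i) :
    (t : ℝ) ∈ Set.Icc (X.pt 0) (X.pt (Fin.last (k + 1))) :=
  ⟨(X.strictMono.monotone (Fin.zero_le _)).trans t.2.1,
    t.2.2.trans (X.strictMono.monotone (Fin.le_last _))⟩

theorem Knots.le_of_lt_seg (X : Knots k) {i j : Fin (k + 1)} (hij : i < j) (s : X.Seg i)
    (t : X.Seg j) : (s : ℝ) ≤ t :=
  s.2.2.trans ((X.strictMono.monotone (Fin.succ_le_castSucc_iff.2 hij)).trans t.2.1)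

theorem Knots.eq_knot_of_lt (X : Knots k) {i j : Fin (k + 1)} (hij : i < j) {t : ℝ}
    (hi : t ∈ Set.Icc (X.pt i.castSucc) (X.pt i.succ))
    (hj : t ∈ Set.Icc (X.pt j.castSucc) (X.pt j.succ)) :
    ∃ q : Fin k, i = q.castSucc ∧ j = q.succ ∧ t = X.right q.castSucc := by
  have hi' : i ≠ Fin.last k := ((Fin.le_last j).trans_lt' hij).ne
  obtain ⟨q, rfl⟩ := Fin.exists_castSucc_eq.2 hi'
  have h1 : X.pt q.castSucc.succ ≤ X.pt j.castSucc :=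
    X.strictMono.monotone (Fin.succ_le_castSucc_iff.2 hij)
  have h2 : t = X.pt q.castSucc.succ := le_antisymm hi.2 (h1.trans hj.1)
  refine ⟨q, rfl, ?_, h2⟩
  have h3 : X.pt j.castSucc = X.pt q.castSucc.succ := le_antisymm (hj.1.trans h2.le) h1
  have h4 := congrArg Fin.val (X.strictMono.injective h3)
  ext
  simpa using h4

/-- All derivatives of order less than `r` vanish at `t`, from both sides. -/
def PVanish (F : PFun X) (t : ℝ) (r : ℕ) : Prop :=
  ∀ s < r, ∀ (i : Fin (k + 1)) (h : t ∈ Set.Icc (X.pt i.castSucc) (X.pt i.succ)),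
    (segDeriv^[s] (F i)) ⟨t, h⟩ = 0

theorem PVanish.mono {F : PFun X} {t : ℝ} {r s : ℕ} (h : PVanish F t r) (hs : s ≤ r) :
    PVanish F t s := fun q hq => h q (hq.trans_le hs)

theorem pvanish_zeroMult (n : ℕ) (F : PFun X) (t : ℝ) : PVanish F t (zeroMult n F t) := by
  have h := fun inst => @Nat.findGreatest_spec 0 (PVanish F t) inst n (Nat.zero_le n)
    fun s hs => by omega
  exact h _

theorem zeroMult_le (n : ℕ) (F : PFun X) (t : ℝ) : zeroMult n F t ≤ n :=
  Nat.findGreatest_le n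

theorem PVanish.le_zeroMult {n r : ℕ} {F : PFun X} {t : ℝ} (h : PVanish F t r) (hr : r ≤ n) :
    r ≤ zeroMult n F t := by
  classical
  exact Nat.le_findGreatest hr h

theorem sum_zeroMult_le_numZeros (n : ℕ) (F : PFun X)
    (T : Finset (Set.Icc (X.pt 0) (X.pt (Fin.last (k + 1))))) :
    ((∑ t ∈ T, zeroMult n F t : ℕ) : ℕ∞) ≤ numZeros n F :=
  le_iSup (fun T : Finset (Set.Icc (X.pt 0) (X.pt (Fin.last (k + 1)))) =>
    ((∑ t ∈ T, zeroMult n F t : ℕ) : ℕ∞)) T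

theorem zeroMult_succ_le (n : ℕ) (F : PFun X) (t : ℝ) :
    zeroMult (n + 1) F t ≤ zeroMult n (pderiv F) t + 1 := by
  have h := pvanish_zeroMult (n + 1) F t
  have h2 := zeroMult_le (n + 1) F t
  rcases hM : zeroMult (n + 1) F t with _ | M
  · omega
  · rw [hM] at h h2
    have : PVanish (pderiv F) t M := fun s hs i hi => h (s + 1) (by omega) i hi
    exact Nat.succ_le_succ (this.le_zeroMult (by omega))

/-- A nonzero element of an ECP-space has less than `n` zeros. -/
theorem IsECPSpace.eq_zero {n : ℕ} {V : Set (PFun X)} (hV : IsECPSpace n V) {F : PFun X}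
    (hF : F ∈ V) (T : Finset (Set.Icc (X.pt 0) (X.pt (Fin.last (k + 1)))))
    (μ : Set.Icc (X.pt 0) (X.pt (Fin.last (k + 1))) → ℕ)
    (hμ : ∀ t ∈ T, PVanish F t (μ t)) (hn : ∀ t ∈ T, μ t ≤ n) (hsum : n ≤ ∑ t ∈ T, μ t) :
    F = 0 := by
  by_contra hne
  have h1 := (sum_zeroMult_le_numZeros n F T).trans (hV.numZeros_le F hF hne)
  have h2 : ∑ t ∈ T, zeroMult n F t ≤ n - 1 := by exact_mod_cast h1
  have h3 : ∑ t ∈ T, μ t ≤ ∑ t ∈ T, zeroMult n F t :=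
    Finset.sum_le_sum fun t ht => (hμ t ht).le_zeroMult (hn t ht)
  have := hV.one_le
  omega

theorem Knots.first_lt_last (X : Knots k) : X.pt 0 < X.pt (Fin.last (k + 1)) :=
  X.strictMono (Fin.last_pos)

theorem IsECPSpace.eq_zero_of_pvanish {n : ℕ} {V : Set (PFun X)} (hV : IsECPSpace n V)
    {F : PFun X} (hF : F ∈ V) {t : ℝ} (ht : t ∈ Set.Icc (X.pt 0) (X.pt (Fin.last (k + 1))))
    (h : PVanish F t n) : F = 0 :=
  hV.eq_zero hF {⟨t, ht⟩} (fun _ => n) (by simpa using h) (by simp) (by simp)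

/-- The zero bound in the form used for Wronskians, with zeros shared between both ends and one
interior point. Taking `q = 0` gives pure two-point conditions. -/
theorem IsECPSpace.eq_zero_of_three {n : ℕ} {V : Set (PFun X)} (hV : IsECPSpace n V)
    {F : PFun X} (hF : F ∈ V) {t : ℝ} (h1 : X.pt 0 < t) (h2 : t < X.pt (Fin.last (k + 1)))
    {p q s : ℕ} (hp : PVanish F (X.pt 0) p) (hq : PVanish F t q)
    (hs : PVanish F (X.pt (Fin.last (k + 1))) s) (hn : p + q + s = n) : F = 0 := by
  classical
  have h12 := h1.trans h2
  let a : Set.Icc (X.pt 0) (X.pt (Fin.last (k + 1))) := ⟨X.pt 0, le_rfl, h12.le⟩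
  let b : Set.Icc (X.pt 0) (X.pt (Fin.last (k + 1))) := ⟨X.pt (Fin.last (k + 1)), h12.le, le_rfl⟩
  let x : Set.Icc (X.pt 0) (X.pt (Fin.last (k + 1))) := ⟨t, h1.le, h2.le⟩
  have hax : a ≠ x := fun h => h1.ne (congrArg Subtype.val h)
  have hxb : x ≠ b := fun h => h2.ne (congrArg Subtype.val h)
  have hab : a ≠ b := fun h => h12.ne (congrArg Subtype.val h)
  refine hV.eq_zero hF {a, x, b} (fun y => if y = a then p else if y = x then q else s) ?_ ?_ ?_
  · intro y hy
    simp only [Finset.mem_insert, Finset.mem_singleton] at hy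
    rcases hy with rfl | rfl | rfl
    · simpa using hp
    · simpa [hax.symm] using hq
    · simpa [hab.symm, hxb.symm] using hs
  · intro y _
    split_ifs <;> omega
  · rw [Finset.sum_insert (by simp [hax, hab]), Finset.sum_pair hxb]
    simp only [if_true, hax.symm, hab.symm, hxb.symm, if_false]
    omega

/-- `F` has no jump at the interior knots. -/
def PMatch (F : PFun X) : Prop :=
  ∀ q : Fin k, F q.succ (X.left q.succ) = F q.castSucc (X.right q.castSucc)

/-- The derivatives from the two sides of every interior knot are connected as by a lower
triangular matrix with positive diagonal. -/
def KnotConn (n : ℕ) (V : Set (PFun X)) : Prop :=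
  ∀ q : Fin k, ∃ ρ : ℕ → ℝ, (∀ r, 0 < ρ r) ∧ ∀ F ∈ V, ∀ r < n,
    (∀ s < r, segDeriv^[s] (F q.castSucc) (X.right q.castSucc) = 0) →
      segDeriv^[r] (F q.succ) (X.left q.succ) =
        ρ r * segDeriv^[r] (F q.castSucc) (X.right q.castSucc)

theorem KnotConn.left_of_right {n : ℕ} {V : Set (PFun X)} (hV : KnotConn n V) {F : PFun X}
    (hF : F ∈ V) {q : Fin k} {r : ℕ} (hr : r ≤ n)
    (h : ∀ s < r, segDeriv^[s] (F q.castSucc) (X.right q.castSucc) = 0) :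
    ∀ s < r, segDeriv^[s] (F q.succ) (X.left q.succ) = 0 := by
  obtain ⟨ρ, -, h2⟩ := hV q
  intro s hs
  rw [h2 F hF s (by omega) fun a ha => h a (by omega), h s hs, mul_zero]

theorem KnotConn.right_of_left {n : ℕ} {V : Set (PFun X)} (hV : KnotConn n V) {F : PFun X}
    (hF : F ∈ V) {q : Fin k} {r : ℕ} (hr : r ≤ n)
    (h : ∀ s < r, segDeriv^[s] (F q.succ) (X.left q.succ) = 0) :
    ∀ s < r, segDeriv^[s] (F q.castSucc) (X.right q.castSucc) = 0 := by
  obtain ⟨ρ, h1, h2⟩ := hV q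
  intro s
  induction s using Nat.strong_induction_on with
  | _ s ih =>
    intro hs
    have := h2 F hF s (by omega) fun a ha => ih a ha (by omega)
    rw [h s hs] at this
    exact (mul_eq_zero.1 this.symm).resolve_left (h1 s).ne'

/-- A triangular relation with positive diagonal transports vanishing of the leading derivatives
across a knot in both directions, so a one-sided zero is a zero from both sides with the same
multiplicity. -/
theorem KnotConn.pvanish {n : ℕ} {V : Set (PFun X)} (hV : KnotConn n V) {F : PFun X}
    (hF : F ∈ V) {r : ℕ} (hr : r ≤ n) {i : Fin (k + 1)} {t : X.Seg i}
    (h : ∀ s < r, segDeriv^[s] (F i) t = 0) : PVanish F t r := by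
  intro s hs j hj
  rcases lt_trichotomy i j with hij | rfl | hij
  · obtain ⟨q, rfl, rfl, ht⟩ := X.eq_knot_of_lt hij t.2 hj
    have e1 : t = X.right q.castSucc := Subtype.ext ht
    have e2 : (⟨t, hj⟩ : X.Seg q.succ) = X.left q.succ := Subtype.ext ht
    rw [e2]
    exact hV.left_of_right hF hr (by rwa [e1] at h) s hs
  · exact h s hs
  · obtain ⟨q, rfl, rfl, ht⟩ := X.eq_knot_of_lt hij hj t.2
    have e1 : t = X.left q.succ := Subtype.ext ht
    have e2 : (⟨t, hj⟩ : X.Seg q.castSucc) = X.right q.castSucc := Subtype.ext ht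
    rw [e2]
    exact hV.right_of_left hF hr (by rwa [e1] at h) s hs

theorem PContDiff.of_le {m n : ℕ} {F : PFun X} (hF : PContDiff n F) (h : m ≤ n) :
    PContDiff m F := fun i => (hF i).of_le h

/-- At a knot both one-sided values have to be positive. The points where this fails form a finite
union of closed sets, one for each segment. -/
theorem isOpen_forall_mem_seg {Q : PFun X} (hc : ∀ i, Continuous (Q i)) :
    IsOpen {t : ℝ | ∀ (i : Fin (k + 1)) (h : t ∈ Set.Icc (X.pt i.castSucc) (X.pt i.succ)),
      0 < Q i ⟨t, h⟩} := by
  rw [Set.ofPred_forall]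
  refine isOpen_iInter_of_finite fun i => ?_
  rw [← isClosed_compl_iff]
  have h1 : IsClosed (Subtype.val '' {t : X.Seg i | Q i t ≤ 0}) :=
    (isClosed_le (hc i) continuous_const).trans isClosed_Icc
  convert h1 using 1
  ext t
  simp only [Set.mem_compl_iff, Set.mem_ofPred_eq, not_forall, not_lt, Set.mem_image,
    Subtype.exists, exists_and_right, exists_eq_right]

/-- The points where all one-sided values are positive, and those where all are negative, form open
sets; they cover (p, q) since the two values at a knot have equal sign. Connectedness excludes that
both occur. -/
theorem sign_const {Q : PFun X} (hc : ∀ i, Continuous (Q i)) {p q : ℝ}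
    (hp : X.pt 0 ≤ p) (hq : q ≤ X.pt (Fin.last (k + 1)))
    (hne : ∀ i (t : X.Seg i), p < t → t < q → Q i t ≠ 0)
    (hk : ∀ l : Fin k, p < X.left l.succ → X.left l.succ < q →
      0 < Q l.succ (X.left l.succ) * Q l.castSucc (X.right l.castSucc)) :
    (∀ i (t : X.Seg i), p < t → t < q → 0 < Q i t) ∨
      ∀ i (t : X.Seg i), p < t → t < q → Q i t < 0 := by
  have hA := isOpen_forall_mem_seg hc
  have hB := isOpen_forall_mem_seg (Q := fun i => -Q i) fun i => (hc i).neg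
  have hagree : ∀ (i j : Fin (k + 1)) (t : X.Seg i) (s : X.Seg j), (t : ℝ) = s → p < t → t < q →
      0 < Q i t * Q j s := by
    intro i j t s hts h1 h2
    rcases lt_trichotomy i j with hij | rfl | hij
    · obtain ⟨l, rfl, rfl, ht⟩ := X.eq_knot_of_lt hij t.2 (hts ▸ s.2)
      have e1 : t = X.right l.castSucc := Subtype.ext ht
      have e2 : s = X.left l.succ := Subtype.ext (hts.symm.trans ht)
      rw [mul_comm, e1, e2]
      refine hk l ?_ ?_
      · rwa [← e2, ← hts]
      · rwa [← e2, ← hts]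
    · rw [Subtype.ext hts]
      exact mul_self_pos.2 (hne i s (hts ▸ h1) (hts ▸ h2))
    · obtain ⟨l, rfl, rfl, ht⟩ := X.eq_knot_of_lt hij s.2 (hts ▸ t.2)
      have e1 : t = X.left l.succ := Subtype.ext (hts.trans ht)
      have e2 : s = X.right l.castSucc := Subtype.ext ht
      rw [e1, e2]
      refine hk l ?_ ?_
      · rwa [← e1]
      · rwa [← e1]
  have hrange : ∀ t, p < t → t < q → t ∈ Set.Icc (X.pt 0) (X.pt (Fin.last (k + 1))) :=
    fun t h1 h2 => ⟨hp.trans h1.le, h2.le.trans hq⟩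
  by_contra hcon
  push Not at hcon
  obtain ⟨⟨i, t, h1, h2, h3⟩, j, s, h4, h5, h6⟩ := hcon
  have h3' : Q i t < 0 := lt_of_le_of_ne h3 (hne i t h1 h2)
  have h6' : 0 < Q j s := lt_of_le_of_ne h6 (hne j s h4 h5).symm
  obtain ⟨x, hx, hxA, hxB⟩ := isPreconnected_Ioo (a := p) (b := q) _ _ hA hB (by
      intro x hx
      obtain ⟨i, hi⟩ := X.exists_seg (hrange x hx.1 hx.2)
      rcases lt_or_gt_of_ne (hne i ⟨x, hi⟩ hx.1 hx.2) with h | h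
      · refine Or.inr fun j hj => ?_
        exact neg_pos.2 (neg_iff_neg_of_mul_pos (hagree i j ⟨x, hi⟩ ⟨x, hj⟩ rfl hx.1 hx.2) |>.1 h)
      · refine Or.inl fun j hj => ?_
        exact (pos_iff_pos_of_mul_pos (hagree i j ⟨x, hi⟩ ⟨x, hj⟩ rfl hx.1 hx.2)).1 h)
    ⟨s, ⟨h4, h5⟩, fun i' hi' =>
      (pos_iff_pos_of_mul_pos (hagree j i' s ⟨s, hi'⟩ rfl h4 h5)).1 h6'⟩
    ⟨t, ⟨h1, h2⟩, fun i' hi' => neg_pos.2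
      ((neg_iff_neg_of_mul_pos (hagree i i' t ⟨t, hi'⟩ rfl h1 h2)).1 h3')⟩
  obtain ⟨i, hi⟩ := X.exists_seg (hrange x hx.1 hx.2)
  exact absurd (hxA i hi) (not_lt.2 (neg_pos.1 (hxB i hi)).le)

/-- Monotonicity on each segment is glued at the knots, where there is no jump, by induction on the
segment of the later point. -/
theorem lt_of_pderiv_pos {H : PFun X} (h1 : PContDiff 1 H) (hm : PMatch H) {p q : ℝ}
    (hpos : ∀ i (t : X.Seg i), p < t → t < q → 0 < pderiv H i t) {i j : Fin (k + 1)}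
    (s : X.Seg i) (t : X.Seg j) (hps : p ≤ s) (hst : (s : ℝ) < t) (htq : t ≤ q) :
    H i s < H j t := by
  have hseg : ∀ (i : Fin (k + 1)) (s t : X.Seg i), p ≤ s → (s : ℝ) < t → t ≤ q → H i s < H i t :=
    fun i s t hps hst htq => lt_of_segDeriv_pos (h1 i) (Subtype.coe_lt_coe.1 hst)
      fun x hx1 hx2 => hpos i x (hps.trans_lt (Subtype.coe_lt_coe.2 hx1))
        ((Subtype.coe_lt_coe.2 hx2).trans_le htq)
  induction j using Fin.induction with
  | zero =>
    obtain rfl | h0 := eq_or_ne i 0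
    · exact hseg _ s t hps hst htq
    · exact absurd (X.le_of_lt_seg (Fin.pos_of_ne_zero h0) t s) (not_le.2 hst)
  | succ j ih =>
    rcases lt_trichotomy i j.succ with h | rfl | h
    · have e1 : (s : ℝ) ≤ X.left j.succ := X.le_of_lt_seg h s (X.left j.succ)
      have e2 : ((X.left j.succ : X.Seg j.succ) : ℝ) ≤ t := t.2.1
      have e3 : H j.succ (X.left j.succ) ≤ H j.succ t := by
        rcases e2.eq_or_lt with e | e
        · rw [Subtype.ext e]
        · exact (hseg _ _ t (hps.trans e1) e htq).le
      have e4 : H i s ≤ H j.succ (X.left j.succ) := by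
        rw [hm j]
        rcases e1.eq_or_lt with e | e
        · rcases (Fin.le_castSucc_iff.2 h).eq_or_lt with rfl | hlt
          · rw [show s = X.right j.castSucc from Subtype.ext e]
          · have h5 := X.eq_knot_of_lt hlt s.2 (t := s) (by
              rw [e]; exact (X.right j.castSucc).2)
            obtain ⟨l, -, h6, h7⟩ := h5
            have h8 : X.pt l.castSucc.succ = X.pt j.castSucc.succ := h7.symm.trans e
            have h9 := congrArg Fin.val (X.strictMono.injective h8)
            have h10 := congrArg Fin.val h6
            simp at h9 h10
            omega
        · exact (ih (X.right j.castSucc) e (e2.trans htq)).le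
      rcases e1.eq_or_lt with e | e
      · have : H j.succ (X.left j.succ) < H j.succ t :=
          hseg _ _ t (hps.trans e1) (e ▸ hst) htq
        exact e4.trans_lt this
      · have : H i s < H j.succ (X.left j.succ) := by
          rw [hm j]
          exact ih (X.right j.castSucc) e (e2.trans htq)
        exact this.trans_le e3
    · exact hseg _ s t hps hst htq
    · exact absurd (X.le_of_lt_seg h t s) (not_le.2 hst)

theorem exists_const_of_pderiv_eq_zero {H : PFun X} (h1 : PContDiff 1 H) (hm : PMatch H)
    (h0 : pderiv H = 0) : ∃ c : ℝ, H = fun _ _ => c := by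
  have hseg : ∀ i (s t : X.Seg i), H i s = H i t := fun i s t =>
    eq_of_segDeriv_eq_zero (h1 i) (fun x => congrFun (congrFun h0 i) x) s t
  refine ⟨H 0 (X.left 0), ?_⟩
  funext i
  induction i using Fin.induction with
  | zero => exact funext fun t => hseg 0 _ _
  | succ i ih =>
    funext t
    rw [hseg _ t (X.left i.succ), hm i, ih]

/-- Rolle's theorem for piecewise functions without jumps whose derivative changes at the interior
knots by positive factors. -/
theorem exists_pvanish_pderiv {H : PFun X} (h1 : PContDiff 1 H) (hm : PMatch H)
    (hρ : ∀ q : Fin k, ∃ ρ : ℝ, 0 < ρ ∧ pderiv H q.succ (X.left q.succ) =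
      ρ * pderiv H q.castSucc (X.right q.castSucc)) {p q : ℝ} (hp : X.pt 0 ≤ p) (hpq : p < q)
    (hq : q ≤ X.pt (Fin.last (k + 1))) (hHp : PVanish H p 1) (hHq : PVanish H q 1) :
    ∃ ξ, p < ξ ∧ ξ < q ∧ PVanish (pderiv H) ξ 1 := by
  by_contra hcon
  push Not at hcon
  -- The positive factor at each knot makes a one-sided zero of the derivative vanish from both
  -- sides.
  have hconn : KnotConn 1 {pderiv H} := by
    intro l
    obtain ⟨ρ, hρ0, hρ⟩ := hρ l
    refine ⟨fun _ => ρ, fun _ => hρ0, ?_⟩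
    rintro F rfl r hr -
    obtain rfl : r = 0 := by omega
    exact hρ
  have hne : ∀ i (t : X.Seg i), p < t → t < q → pderiv H i t ≠ 0 := by
    intro i t h1 h2 h0
    refine hcon t h1 h2 (hconn.pvanish rfl le_rfl (i := i) (t := t) fun s hs => ?_)
    obtain rfl : s = 0 := by omega
    exact h0
  have hcont : ∀ i, Continuous (pderiv H i) := fun i =>
    (SegContDiff.segDeriv (n := 0) (X.seg_lt i) (h1 i)).continuous
  have hsign := sign_const hcont hp hq hne fun l hl1 hl2 => by
    obtain ⟨ρ, hρ0, hρ⟩ := hρ l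
    have := hne l.castSucc (X.right l.castSucc) hl1 hl2
    rw [hρ, mul_assoc]
    exact mul_pos hρ0 (mul_self_pos.2 this)
  obtain ⟨i, hi⟩ := X.exists_seg (t := p) ⟨hp, hpq.le.trans hq⟩
  obtain ⟨j, hj⟩ := X.exists_seg (t := q) ⟨hp.trans hpq.le, hq⟩
  have e1 : H i ⟨p, hi⟩ = 0 := hHp 0 (by omega) i hi
  have e2 : H j ⟨q, hj⟩ = 0 := hHq 0 (by omega) j hj
  rcases hsign with hs | hs
  · have := lt_of_pderiv_pos h1 hm hs ⟨p, hi⟩ ⟨q, hj⟩ le_rfl hpq le_rfl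
    rw [e1, e2] at this
    exact lt_irrefl _ this
  · have hneg : ∀ i, pderiv (fun i => (-1 : ℝ) • H i) i = (-1 : ℝ) • pderiv H i := fun i =>
      segDeriv_smul (X.seg_lt i) (h1 i) (-1)
    have := lt_of_pderiv_pos (H := fun i => (-1 : ℝ) • H i) (p := p) (q := q)
      (fun i => (h1 i).smul (-1)) (fun l => by simp [hm l])
      (fun i t h1 h2 => by rw [hneg]; simpa using hs i t h1 h2) ⟨p, hi⟩ ⟨q, hj⟩ le_rfl hpq le_rfl
    simp [e1, e2] at this

/-- A zero loses at most one multiplicity under differentiation, while Rolle supplies a new zero of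
the derivative between neighbouring zeros; only one zero is lost in total. -/
theorem numZeros_succ_le {H : PFun X} (h1 : PContDiff 1 H) (hm : PMatch H)
    (hρ : ∀ q : Fin k, ∃ ρ : ℝ, 0 < ρ ∧ pderiv H q.succ (X.left q.succ) =
      ρ * pderiv H q.castSucc (X.right q.castSucc)) {n : ℕ} (hn : 1 ≤ n) :
    numZeros (n + 1) H ≤ numZeros n (pderiv H) + 1 := by
  classical
  -- Zeros are added from left to right. That every point of `T'` lies below some point of `T`
  -- ensures that the next Rolle point is new.
  have key : ∀ T : Finset (Set.Icc (X.pt 0) (X.pt (Fin.last (k + 1)))),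
      (∀ t ∈ T, PVanish H t 1) →
      ∃ T' : Finset (Set.Icc (X.pt 0) (X.pt (Fin.last (k + 1)))),
        (∀ t ∈ T', ∃ s ∈ T, t ≤ s) ∧
        ∑ t ∈ T, zeroMult (n + 1) H t ≤ (∑ t ∈ T', zeroMult n (pderiv H) t) + 1 := by
    intro T
    induction T using Finset.induction_on_max with
    | empty => exact fun _ => ⟨∅, by simp, by simp⟩
    | insert x s hx ih =>
      intro hT
      have hxs : x ∉ s := fun h => lt_irrefl _ (hx x h)
      rcases s.eq_empty_or_nonempty with rfl | hs
      · refine ⟨{x}, by simp, ?_⟩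
        simpa using zeroMult_succ_le n H x
      · obtain ⟨T', h2, h3⟩ := ih fun t ht => hT t (Finset.mem_insert_of_mem ht)
        have hM := s.max'_mem hs
        obtain ⟨ξ, hξ1, hξ2, hξ⟩ := exists_pvanish_pderiv h1 hm hρ (s.max' hs).2.1
          (Subtype.coe_lt_coe.2 (hx _ hM)) x.2.2 (hT _ (Finset.mem_insert_of_mem hM))
          (hT x (Finset.mem_insert_self _ _))
        let y : Set.Icc (X.pt 0) (X.pt (Fin.last (k + 1))) :=
          ⟨ξ, (s.max' hs).2.1.trans hξ1.le, hξ2.le.trans x.2.2⟩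
        have hyx : y < x := Subtype.coe_lt_coe.1 hξ2
        have hlt : ∀ t ∈ T', t < y := fun t ht => by
          obtain ⟨u, hu, htu⟩ := h2 t ht
          exact (htu.trans (s.le_max' u hu)).trans_lt (Subtype.coe_lt_coe.1 hξ1)
        have hy : y ∉ T' := fun h => lt_irrefl _ (hlt y h)
        have hx' : x ∉ insert y T' := by
          rw [Finset.mem_insert]
          rintro (h | h)
          · exact hyx.ne h.symm
          · exact lt_asymm (hlt x h) hyx
        refine ⟨insert x (insert y T'), fun t ht => ⟨x, Finset.mem_insert_self _ _, ?_⟩, ?_⟩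
        · rw [Finset.mem_insert, Finset.mem_insert] at ht
          rcases ht with rfl | rfl | ht
          · exact le_rfl
          · exact hyx.le
          · exact ((hlt t ht).trans hyx).le
        · rw [Finset.sum_insert hxs, Finset.sum_insert hx', Finset.sum_insert hy]
          have e1 := zeroMult_succ_le n H x
          have e2 : 1 ≤ zeroMult n (pderiv H) y := hξ.le_zeroMult hn
          omega
  refine iSup_le fun T => ?_
  obtain ⟨T', -, h⟩ := key (T.filter fun t : Set.Icc (X.pt 0) (X.pt (Fin.last (k + 1))) => PVanish H (t : ℝ) 1) fun t ht =>
    (Finset.mem_filter.1 ht).2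
  have h2 : ∑ t ∈ T, zeroMult (n + 1) H t =
      ∑ t ∈ T.filter (fun t : Set.Icc (X.pt 0) (X.pt (Fin.last (k + 1))) => PVanish H t 1),
        zeroMult (n + 1) H t := by
    rw [Finset.sum_filter_of_ne]
    intro t _ ht
    exact (pvanish_zeroMult (n + 1) H t).mono (Nat.one_le_iff_ne_zero.2 ht)
  rw [h2]
  calc _
      ≤ (((∑ t ∈ T', zeroMult n (pderiv H) t) + 1 : ℕ) : ℕ∞) := by exact_mod_cast h
    _ = ((∑ t ∈ T', zeroMult n (pderiv H) t : ℕ) : ℕ∞) + 1 := by push_cast; rfl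
    _ ≤ _ := by gcongr; exact sum_zeroMult_le_numZeros n (pderiv H) T'

end Piecewise

end PCSpline

namespace PCSpline

/-! ### One step of the recursion and preservation of total positivity -/

section Levels

variable {k : ℕ} {X : Knots k}

theorem pderiv_sum_smul {ι : Type*} {s : Finset ι} {F : ι → PFun X}
    (hF : ∀ l ∈ s, PContDiff 1 (F l)) (c : ι → ℝ) :
    pderiv (∑ l ∈ s, c l • F l) = ∑ l ∈ s, c l • pderiv (F l) := by
  funext i t
  have h := segDeriv_iterate_sum_smul (X.seg_lt i) (r := 1) (f := fun l => F l i) (s := s)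
    (fun l hl => hF l hl i) c t
  simpa [pderiv, Finset.sum_apply] using h

theorem pderiv_add {F G : PFun X} (hF : PContDiff 1 F) (hG : PContDiff 1 G) :
    pderiv (F + G) = pderiv F + pderiv G :=
  funext fun i => segDeriv_add (X.seg_lt i) (hF i) (hG i)

theorem pderiv_smul {F : PFun X} (hF : PContDiff 1 F) (c : ℝ) :
    pderiv (c • F) = c • pderiv F :=
  funext fun i => segDeriv_smul (X.seg_lt i) (hF i) c

theorem pderiv_const (c : ℝ) : pderiv (fun _ _ => c : PFun X) = 0 :=
  funext fun i => segDeriv_const (X.seg_lt i) c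

theorem pContDiff_const (n : ℕ) (c : ℝ) : PContDiff n (fun _ _ => c : PFun X) :=
  fun _ => segContDiff_const n c

theorem PContDiff.add {n : ℕ} {F G : PFun X} (hF : PContDiff n F) (hG : PContDiff n G) :
    PContDiff n (F + G) := fun i => (hF i).add (hG i)

theorem PContDiff.smul {n : ℕ} {F : PFun X} (hF : PContDiff n F) (c : ℝ) :
    PContDiff n (c • F) := fun i => (hF i).smul c

theorem PContDiff.sum {ι : Type*} {n : ℕ} {s : Finset ι} {F : ι → PFun X}
    (hF : ∀ l ∈ s, PContDiff n (F l)) : PContDiff n (∑ l ∈ s, F l) := fun i => by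
  rw [Finset.sum_apply]
  exact SegContDiff.sum fun l hl => hF l hl i

theorem PContDiff.pderiv {n : ℕ} {F : PFun X} (hF : PContDiff (n + 1) F) :
    PContDiff n (pderiv F) := fun i => (hF i).segDeriv (X.seg_lt i)

theorem PContDiff.div {n : ℕ} {F w : PFun X} (hF : PContDiff n F) (hw : PContDiff n w)
    (h0 : PPositive w) : PContDiff n (F / w) := fun i => (hF i).div (hw i) fun t => (h0 i t).ne'

theorem PPositive.mul_div_cancel {w : PFun X} (h0 : PPositive w) (F : PFun X) :
    w * (F / w) = F := by
  funext i t
  exact mul_div_cancel₀ (F i t) (h0 i t).ne'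

theorem PPositive.eq_of_div_eq {w : PFun X} (h0 : PPositive w) {F G : PFun X}
    (h : F / w = G / w) : F = G := by
  rw [← h0.mul_div_cancel F, h, h0.mul_div_cancel]

/-- Subtracting the constant value of F at the knot does not change DF and makes the value vanish,
so the relation of order r + 1 for F becomes that of order r for DF. -/
theorem KnotConn.pderiv {n : ℕ} {V : Submodule ℝ (PFun X)} (hV : KnotConn (n + 1) (V : Set (PFun X)))
    (hone : (1 : PFun X) ∈ V) (hd : ∀ F ∈ V, PContDiff 1 F) :
    KnotConn n (pderiv '' (V : Set (PFun X))) := by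
  intro q
  obtain ⟨ρ, h1, h2⟩ := hV q
  refine ⟨fun r => ρ (r + 1), fun r => h1 _, ?_⟩
  rintro _ ⟨F, hF, rfl⟩ r hr h
  set c := F q.castSucc (X.right q.castSucc) with hc
  have hG : F + (-c) • (1 : PFun X) ∈ V := V.add_mem hF (V.smul_mem _ hone)
  have hDG : PCSpline.pderiv (F + (-c) • (1 : PFun X)) = PCSpline.pderiv F := by
    rw [pderiv_add (hd F hF) (hd _ (V.smul_mem _ hone)), pderiv_smul (hd _ hone),
      show (1 : PFun X) = fun _ _ => 1 from rfl, pderiv_const]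
    simp
  have hDGi : ∀ i, segDeriv ((F + (-c) • (1 : PFun X)) i) = segDeriv (F i) :=
    fun i => congrFun hDG i
  have := h2 _ hG (r + 1) (by omega) fun s hs => by
    cases s with
    | zero => simp [hc]
    | succ s =>
      rw [Function.iterate_succ_apply, hDGi]
      exact h s (by omega)
  rwa [Function.iterate_succ_apply, Function.iterate_succ_apply, hDGi, hDGi] at this

/-- The constant 1 forces the diagonal factor of order zero to be 1. -/
theorem KnotConn.pMatch {n : ℕ} {V : Set (PFun X)} (hV : KnotConn (n + 1) V)
    (hone : (1 : PFun X) ∈ V) {F : PFun X} (hF : F ∈ V) : PMatch F := by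
  intro q
  obtain ⟨ρ, -, h2⟩ := hV q
  have e1 := h2 1 hone 0 (by omega) fun s hs => by omega
  have e2 := h2 F hF 0 (by omega) fun s hs => by omega
  simp only [Function.iterate_zero, id, Pi.one_apply, mul_one] at e1 e2
  rw [e2, ← e1, one_mul]

theorem KnotConn.div {n : ℕ} {E : Set (PFun X)} (hE : KnotConn (n + 1) E)
    (hd : ∀ F ∈ E, PContDiff n F) {w : PFun X} (hw : w ∈ E) (h0 : PPositive w) :
    KnotConn (n + 1) ((fun F => F / w) '' E) := by
  intro q
  have hEq := hE q
  obtain ⟨ρ, h1, h2⟩ := hEq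
  -- As `w` lies in `E`, its own one-sided values differ by the factor `ρ 0`, which is divided out
  -- of every leading coefficient.
  refine ⟨fun r => ρ r / ρ 0, fun r => div_pos (h1 _) (h1 _), ?_⟩
  rintro _ ⟨F, hF, rfl⟩ r hr h
  have hG : PContDiff n (F / w) := (hd F hF).div (hd w hw) h0
  have hmul : ∀ i, F i = w i * (F / w) i := fun i =>
    (congrFun (h0.mul_div_cancel F) i).symm
  have hwk := h2 w hw 0 (by omega) fun s hs => by omega
  simp only [Function.iterate_zero, id] at hwk
  have hFv : ∀ s < r, segDeriv^[s] (F q.castSucc) (X.right q.castSucc) = 0 := by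
    rw [hmul]
    exact (vanish_mul_iff (X.seg_lt _) (hd w hw _) (hG _) (by omega) (h0 _ _).ne').2 h
  have hFv' := hE.left_of_right hF (by omega) hFv
  have hGv' : ∀ s < r, segDeriv^[s] ((F / w) q.succ) (X.left q.succ) = 0 := by
    rw [hmul] at hFv'
    exact (vanish_mul_iff (X.seg_lt _) (hd w hw _) (hG _) (by omega) (h0 _ _).ne').1 hFv'
  have e := h2 F hF r hr hFv
  rw [hmul q.succ, hmul q.castSucc,
    segDeriv_iterate_mul_of_vanish (X.seg_lt _) ((hd w hw _).of_le (by omega))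
      ((hG _).of_le (by omega)) hGv',
    segDeriv_iterate_mul_of_vanish (X.seg_lt _) ((hd w hw _).of_le (by omega))
      ((hG _).of_le (by omega)) h, hwk] at e
  have e0 := (h1 0).ne'
  have e1 := (h0 q.castSucc (X.right q.castSucc)).ne'
  dsimp only
  rw [div_mul_eq_mul_div, eq_div_iff e0]
  apply mul_left_cancel₀ e1
  linear_combination e

/-- The weight function built from the transition functions `T 1, ..., T N`. -/
noncomputable def levelWeight (N : ℕ) (T : ℕ → PFun X) : PFun X :=
  ∑ h ∈ Finset.Icc 2 N, pderiv (T h)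

/-- The transition functions of the next level. -/
noncomputable def levelNext (N : ℕ) (T : ℕ → PFun X) (l : ℕ) : PFun X :=
  (∑ h ∈ Finset.Icc (l + 1) N, pderiv (T h)) / levelWeight N T

theorem weight_succ_eq (m : ℕ) (f : ℕ → PFun X) (j : ℕ) :
    weight m f (j + 1) = levelWeight (m - j) (transFam m f j) := rfl

theorem transFam_succ_eq (m : ℕ) (f : ℕ → PFun X) (j : ℕ) :
    transFam m f (j + 1) = levelNext (m - j) (transFam m f j) := rfl

/-- `T 1 = 1` and the Wronskians of the derivatives of `T 2, ..., T N` are nonnegative, the full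
one being positive. -/
structure IsTotallyPositiveLevel (N : ℕ) (T : ℕ → PFun X) : Prop where
  one : T 1 = 1
  contDiff : ∀ l ∈ Finset.Icc 1 N, PContDiff (N - 1) (T l)
  nonneg : ∀ (r : ℕ) (J : Fin r → ℕ), StrictMono J → (∀ q, 2 ≤ J q ∧ J q ≤ N) →
    ∀ i t, 0 ≤ segWr (fun q => pderiv (T (J q)) i) t
  pos : ∀ (r : ℕ) (J : Fin r → ℕ), StrictMono J → (∀ q, 2 ≤ J q ∧ J q ≤ N) → r + 1 = N →
    ∀ i t, 0 < segWr (fun q => pderiv (T (J q)) i) t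

namespace IsTotallyPositiveLevel

variable {n : ℕ} {T : ℕ → PFun X}

theorem contDiff_pderiv (hT : IsTotallyPositiveLevel (n + 2) T) {l : ℕ}
    (hl : l ∈ Finset.Icc 2 (n + 2)) : PContDiff n (pderiv (T l)) := by
  rw [Finset.mem_Icc] at hl
  exact PContDiff.pderiv (hT.contDiff l (Finset.mem_Icc.2 ⟨by omega, hl.2⟩))

theorem contDiff_weight (hT : IsTotallyPositiveLevel (n + 2) T) :
    PContDiff n (levelWeight (n + 2) T) :=
  PContDiff.sum fun _ hl => hT.contDiff_pderiv hl

/-- Wronskians of size one give nonnegative summands. If their sum vanished, all of them would, and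
the full Wronskian would have a zero row. -/
theorem weight_pos (hT : IsTotallyPositiveLevel (n + 2) T) :
    PPositive (levelWeight (n + 2) T) := by
  intro i t
  have hnn : ∀ h ∈ Finset.Icc 2 (n + 2), 0 ≤ pderiv (T h) i t := by
    intro h hh
    have := hT.nonneg 1 (fun _ => h) (Subsingleton.strictMono _)
      (fun _ => Finset.mem_Icc.1 hh) i t
    simpa [segWr] using this
  rw [levelWeight, Finset.sum_apply, Finset.sum_apply]
  refine lt_of_le_of_ne (Finset.sum_nonneg hnn) fun h0 => ?_
  have hz := (Finset.sum_eq_zero_iff_of_nonneg hnn).1 h0.symm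
  have hJ : StrictMono fun q : Fin (n + 1) => 2 + (q : ℕ) := fun a b hab => by
    have : (a : ℕ) < b := hab
    simpa using this
  have hmem : ∀ q : Fin (n + 1), 2 ≤ 2 + (q : ℕ) ∧ 2 + (q : ℕ) ≤ n + 2 := fun q => by omega
  have := hT.pos (n + 1) _ hJ hmem rfl i t
  rw [segWr, Matrix.det_eq_zero_of_row_eq_zero (0 : Fin (n + 1))] at this
  · exact lt_irrefl _ this
  · exact fun q => hz _ (Finset.mem_Icc.2 (hmem q))

theorem contDiff_next (hT : IsTotallyPositiveLevel (n + 2) T) {l : ℕ} (hl : 1 ≤ l) :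
    PContDiff n (levelNext (n + 2) T l) := by
  refine (PContDiff.sum fun h hh => hT.contDiff_pderiv ?_).div hT.contDiff_weight hT.weight_pos
  rw [Finset.mem_Icc] at hh ⊢
  omega

theorem next_one (hT : IsTotallyPositiveLevel (n + 2) T) : levelNext (n + 2) T 1 = 1 := by
  funext i t
  exact div_self (hT.weight_pos i t).ne'

/-- The Wronskians of the next level are positive multiples of sums of Wronskians of this
level. -/
theorem segWr_next (hT : IsTotallyPositiveLevel (n + 2) T) {r : ℕ} {K : Fin (r + 1) → ℕ}
    (hK : StrictMono K) (h0 : K 0 = 1) (hmem : ∀ q, K q ≤ n + 1) (i : Fin (k + 1))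
    (t : X.Seg i) :
    levelWeight (n + 2) T i t ^ (r + 1) *
        segWr (fun q : Fin r => pderiv (levelNext (n + 2) T (K q.succ)) i) t =
      ∑ p ∈ Fintype.piFinset fun q => Finset.Ioc (K q) (nextIndex K (n + 2) q),
        segWr (fun q => pderiv (T (p q)) i) t := by
  have hK1 : ∀ q, 1 ≤ K q := fun q => h0 ▸ hK.monotone (Fin.zero_le q)
  have hr := card_le_of_strictMono hK fun q => ⟨hK1 q, hmem q⟩
  have hV : ∀ q, SegContDiff (r + 1 - 1) (levelNext (n + 2) T (K q) i) := fun q =>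
    (hT.contDiff_next (hK1 q) i).of_le (by omega)
  -- Since `K 0 = 1` and the first function of the next level is 1, the Wronskian of derivatives
  -- equals the larger one with 1 prepended; multiplication by the weight then turns its entries
  -- into tail sums.
  have e1 := segWr_cons_one (X.seg_lt i) (g := fun q => levelNext (n + 2) T (K q) i)
    (by rw [h0]; exact congrFun hT.next_one i) t
  have e2 := segWr_mul (X.seg_lt i) ((hT.contDiff_weight i).of_le (by omega)) hV t
  have e3 : (fun q => levelWeight (n + 2) T i * levelNext (n + 2) T (K q) i) =
      fun q => ∑ h ∈ Finset.Ioc (K q) (n + 2), pderiv (T h) i := by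
    funext q
    have := congrFun (hT.weight_pos.mul_div_cancel
      (∑ h ∈ Finset.Icc (K q + 1) (n + 2), pderiv (T h))) i
    rw [Finset.sum_apply, Finset.Icc_add_one_left_eq_Ioc] at this
    rw [← this, levelNext, Finset.Icc_add_one_left_eq_Ioc]
    rfl
  have e4 := det_tail_sums (fun h a => segDeriv^[a] (pderiv (T h) i) t) hK (N := n + 2)
    fun q => (hmem q).trans (by omega)
  have e5 : segWr (fun q => ∑ h ∈ Finset.Ioc (K q) (n + 2), pderiv (T h) i) t =
      Matrix.det (Matrix.of fun a q : Fin (r + 1) => ∑ h ∈ Finset.Ioc (K q) (n + 2),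
        segDeriv^[(a : ℕ)] (pderiv (T h) i) t) := by
    rw [segWr]
    congr 1
    ext a q
    rw [Matrix.of_apply, Matrix.of_apply, segDeriv_iterate_sum (X.seg_lt i), Finset.sum_apply]
    intro h hh
    rw [Finset.mem_Ioc] at hh
    have := hK1 q
    exact (hT.contDiff_pderiv (Finset.mem_Icc.2 ⟨by omega, hh.2⟩) i).of_le (by omega)
  rw [e3, e5, e4, e1] at e2
  exact e2.symm

/-- Prepending the index 1 to `J` expresses its Wronskian, up to a positive factor, as a sum of
Wronskians of the old level with one more index. For the full Wronskian all summands are full ones,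
hence positive. -/
theorem next (hT : IsTotallyPositiveLevel (n + 2) T) :
    IsTotallyPositiveLevel (n + 1) (levelNext (n + 2) T) := by
  have hK : ∀ {r : ℕ} {J : Fin r → ℕ}, StrictMono J → (∀ q, 2 ≤ J q ∧ J q ≤ n + 1) →
      StrictMono (Fin.cons 1 J : Fin (r + 1) → ℕ) ∧
      (∀ q, 1 ≤ (Fin.cons 1 J : Fin (r + 1) → ℕ) q) ∧
      ∀ q, (Fin.cons 1 J : Fin (r + 1) → ℕ) q ≤ n + 1 := by
    intro r J hJ hmem
    refine ⟨fun a b => ?_, Fin.cases ?_ fun q => ?_, Fin.cases ?_ fun q => ?_⟩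
    · refine Fin.cases ?_ (fun b => ?_) b
      · simp
      · refine Fin.cases ?_ (fun a => ?_) a
        · intro _
          simpa using Nat.lt_of_succ_le (hmem b).1
        · intro h
          simpa using hJ (Fin.succ_lt_succ_iff.1 h)
    · simp
    · simpa using (by omega : 1 ≤ 2).trans (hmem q).1
    · simp
    · simpa using (hmem q).2
  have hp : ∀ {r : ℕ} {J : Fin r → ℕ}, StrictMono J → (∀ q, 2 ≤ J q ∧ J q ≤ n + 1) →
      ∀ p ∈ Fintype.piFinset fun q => Finset.Ioc ((Fin.cons 1 J : Fin (r + 1) → ℕ) q)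
        (nextIndex (Fin.cons 1 J : Fin (r + 1) → ℕ) (n + 2) q),
      ∀ q, 2 ≤ p q ∧ p q ≤ n + 2 := by
    intro r J hJ hmem p hp q
    obtain ⟨-, h2, h3⟩ := hK hJ hmem
    have h4 := Finset.mem_Ioc.1 (Fintype.mem_piFinset.1 hp q)
    have h5 := nextIndex_le (N := n + 2) (fun q => (h3 q).trans (by omega)) q
    have := h2 q
    omega
  refine ⟨hT.next_one, fun l hl => hT.contDiff_next (Finset.mem_Icc.1 hl).1,
    fun r J hJ hmem i t => ?_, fun r J hJ hmem hr i t => ?_⟩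
  all_goals
    obtain ⟨h1, h2, h3⟩ := hK hJ hmem
    have h := hT.segWr_next h1 (Fin.cons_zero _ _) h3 i t
    simp only [Fin.cons_succ] at h
    have hw := pow_pos (hT.weight_pos i t) (r + 1)
  · refine nonneg_of_mul_nonneg_right ?_ hw
    rw [h]
    exact Finset.sum_nonneg fun p hpm => hT.nonneg _ p (strictMono_of_mem_blocks hpm)
      (hp hJ hmem p hpm) i t
  · refine (pos_iff_pos_of_mul_pos ?_).1 hw
    rw [h]
    refine Finset.sum_pos (fun p hpm => hT.pos _ p (strictMono_of_mem_blocks hpm)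
      (hp hJ hmem p hpm) (by omega) i t) ⟨nextIndex (Fin.cons 1 J : Fin (r + 1) → ℕ) (n + 2), Fintype.mem_piFinset.2 fun q => ?_⟩
    -- The sum is nonempty: the right end of each block can be chosen.
    exact Finset.mem_Ioc.2 ⟨lt_nextIndex h1 (fun q => (h3 q).trans_lt (by omega)) q, le_rfl⟩

end IsTotallyPositiveLevel

end Levels

end PCSpline

namespace PCSpline

/-! ### The spaces spanned by the levels and their weight functions -/

section LevelSpaces

variable {k : ℕ} {X : Knots k}

/-- The space spanned by `T 1, ..., T N`. -/
def levelSpan (N : ℕ) (T : ℕ → PFun X) : Submodule ℝ (PFun X) :=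
  Submodule.span ℝ (T '' (Finset.Icc 1 N : Finset ℕ))

theorem mem_levelSpan {N : ℕ} {T : ℕ → PFun X} {F : PFun X} :
    F ∈ levelSpan N T ↔ ∃ c : ℕ → ℝ, ∑ l ∈ Finset.Icc 1 N, c l • T l = F :=
  Submodule.mem_span_image_finset_iff_exists_fun' ℝ

theorem self_mem_levelSpan {N l : ℕ} (T : ℕ → PFun X) (hl : l ∈ Finset.Icc 1 N) :
    T l ∈ levelSpan N T := Submodule.subset_span ⟨l, hl, rfl⟩

namespace IsTotallyPositiveLevel

variable {n : ℕ} {T : ℕ → PFun X}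

theorem one_mem (hT : IsTotallyPositiveLevel (n + 1) T) : (1 : PFun X) ∈ levelSpan (n + 1) T :=
  hT.one ▸ self_mem_levelSpan T (by simp)

theorem contDiff_of_mem (hT : IsTotallyPositiveLevel (n + 1) T) {F : PFun X}
    (hF : F ∈ levelSpan (n + 1) T) : PContDiff n F := by
  obtain ⟨c, rfl⟩ := mem_levelSpan.1 hF
  exact PContDiff.sum fun l hl => (hT.contDiff l hl).smul _

theorem pderiv_div_mem (hT : IsTotallyPositiveLevel (n + 2) T) {F : PFun X}
    (hF : F ∈ levelSpan (n + 2) T) :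
    pderiv F / levelWeight (n + 2) T ∈ levelSpan (n + 1) (levelNext (n + 2) T) := by
  obtain ⟨c, rfl⟩ := mem_levelSpan.1 hF
  have hdiv : ∀ s : Finset ℕ, (∑ l ∈ s, c l • pderiv (T l)) / levelWeight (n + 2) T =
      ∑ l ∈ s, c l • (pderiv (T l) / levelWeight (n + 2) T) := fun s => by
    simp only [div_eq_mul_inv, Finset.sum_mul, smul_mul_assoc]
  rw [pderiv_sum_smul fun l hl => (hT.contDiff l hl).of_le (by omega), hdiv]
  refine Submodule.sum_mem _ fun l hl => Submodule.smul_mem _ _ ?_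
  rw [Finset.mem_Icc] at hl
  rcases hl.1.eq_or_lt with rfl | hl1
  · rw [hT.one, show (1 : PFun X) = fun _ _ => 1 from rfl, pderiv_const, div_eq_mul_inv, zero_mul]
    exact Submodule.zero_mem _
  obtain ⟨l, rfl⟩ := Nat.exists_eq_add_of_le' hl1
  -- A single derivative is the difference of two successive tail sums; beyond the last index the
  -- tail sum is zero.
  have hsplit : pderiv (T (l + (1 + 1))) / levelWeight (n + 2) T =
      levelNext (n + 2) T (l + 1) - levelNext (n + 2) T (l + 2) := by
    rw [levelNext, levelNext, div_eq_mul_inv, div_eq_mul_inv, div_eq_mul_inv, ← sub_mul,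
      Finset.Icc_add_one_left_eq_Ioc (l + 2), ← Finset.add_sum_Ioc_eq_sum_Icc (by omega),
      add_sub_cancel_right]
  rw [hsplit]
  have h1 : levelNext (n + 2) T (l + 1) ∈ levelSpan (n + 1) (levelNext (n + 2) T) :=
    self_mem_levelSpan _ (Finset.mem_Icc.2 ⟨by omega, by omega⟩)
  refine Submodule.sub_mem _ h1 ?_
  rcases Nat.lt_or_ge l n with h | h
  · exact self_mem_levelSpan _ (Finset.mem_Icc.2 ⟨by omega, by omega⟩)
  · rw [levelNext, Finset.Icc_eq_empty (by omega), Finset.sum_empty, div_eq_mul_inv, zero_mul]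
    exact Submodule.zero_mem _

theorem exists_pderiv_div_eq (hT : IsTotallyPositiveLevel (n + 2) T) {G : PFun X}
    (hG : G ∈ levelSpan (n + 1) (levelNext (n + 2) T)) :
    ∃ F ∈ levelSpan (n + 2) T, G = pderiv F / levelWeight (n + 2) T := by
  obtain ⟨c, rfl⟩ := mem_levelSpan.1 hG
  -- The next level consists of derivatives of tail sums of the `T h`, divided by the weight, so the
  -- antiderivative can be written down.
  refine ⟨∑ l ∈ Finset.Icc 1 (n + 1), c l • ∑ h ∈ Finset.Icc (l + 1) (n + 2), T h,
    Submodule.sum_mem _ fun l _ => Submodule.smul_mem _ _ (Submodule.sum_mem _ fun h hh =>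
      self_mem_levelSpan T ?_), ?_⟩
  · rw [Finset.mem_Icc] at hh ⊢
    omega
  · have hd : ∀ h ∈ Finset.Icc 1 (n + 2), PContDiff 1 (T h) := fun h hh =>
      (hT.contDiff h hh).of_le (by omega)
    have hmem : ∀ l, ∀ h ∈ Finset.Icc (l + 1) (n + 2), h ∈ Finset.Icc 1 (n + 2) := by
      intro l h hh
      rw [Finset.mem_Icc] at hh ⊢
      omega
    have hsum : ∀ l, pderiv (∑ h ∈ Finset.Icc (l + 1) (n + 2), T h) =
        ∑ h ∈ Finset.Icc (l + 1) (n + 2), pderiv (T h) := fun l => by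
      simpa using pderiv_sum_smul (fun h hh => hd h (hmem l h hh)) fun _ => 1
    rw [pderiv_sum_smul fun l _ => PContDiff.sum fun h hh => hd h (hmem l h hh)]
    simp only [hsum, levelNext, div_eq_mul_inv, Finset.sum_mul, smul_mul_assoc]

theorem coe_levelSpan_next (hT : IsTotallyPositiveLevel (n + 2) T) :
    (levelSpan (n + 1) (levelNext (n + 2) T) : Set (PFun X)) =
      (fun F => F / levelWeight (n + 2) T) '' (pderiv '' (levelSpan (n + 2) T : Set (PFun X))) := by
  ext G
  constructor
  · intro hG
    obtain ⟨F, hF, rfl⟩ := hT.exists_pderiv_div_eq hG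
    exact ⟨_, ⟨F, hF, rfl⟩, rfl⟩
  · rintro ⟨_, ⟨F, hF, rfl⟩, rfl⟩
    exact hT.pderiv_div_mem hF

theorem weight_mem (hT : IsTotallyPositiveLevel (n + 2) T) :
    levelWeight (n + 2) T ∈ pderiv '' (levelSpan (n + 2) T : Set (PFun X)) := by
  refine ⟨∑ h ∈ Finset.Icc 2 (n + 2), T h, Submodule.sum_mem _ fun h hh =>
      self_mem_levelSpan T ?_, ?_⟩
  · rw [Finset.mem_Icc] at hh ⊢
    omega
  · have hd : ∀ h ∈ Finset.Icc 2 (n + 2), PContDiff 1 (T h) := fun h hh => by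
      rw [Finset.mem_Icc] at hh
      exact (hT.contDiff h (Finset.mem_Icc.2 ⟨by omega, hh.2⟩)).of_le (by omega)
    simpa [levelWeight] using pderiv_sum_smul hd fun _ => 1

theorem knotConn_next (hT : IsTotallyPositiveLevel (n + 2) T)
    (hV : KnotConn (n + 2) (levelSpan (n + 2) T : Set (PFun X))) :
    KnotConn (n + 1) (levelSpan (n + 1) (levelNext (n + 2) T) : Set (PFun X)) := by
  rw [hT.coe_levelSpan_next]
  refine (hV.pderiv hT.one_mem fun F hF => (hT.contDiff_of_mem hF).of_le (by omega)).div ?_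
    hT.weight_mem hT.weight_pos
  rintro _ ⟨F, hF, rfl⟩
  exact (hT.contDiff_of_mem hF).pderiv

/-- An antiderivative without jumps is unique up to a single global constant, and the constants lie
in the span. -/
theorem mem_iff_next (hT : IsTotallyPositiveLevel (n + 2) T)
    (hV : KnotConn (n + 2) (levelSpan (n + 2) T : Set (PFun X))) {F : PFun X}
    (hd : PContDiff (n + 1) F) :
    F ∈ levelSpan (n + 2) T ↔ PMatch F ∧
      pderiv F / levelWeight (n + 2) T ∈ levelSpan (n + 1) (levelNext (n + 2) T) := by
  refine ⟨fun hF => ⟨hV.pMatch hT.one_mem hF, hT.pderiv_div_mem hF⟩, ?_⟩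
  rintro ⟨hm, hF⟩
  obtain ⟨G, hG, hFG⟩ := hT.exists_pderiv_div_eq hF
  have hDFG := hT.weight_pos.eq_of_div_eq hFG
  have hGd : PContDiff (n + 1) G := hT.contDiff_of_mem hG
  have hGm := hV.pMatch hT.one_mem hG
  have hd1 : PContDiff 1 F := hd.of_le (by omega)
  have hGd1 : PContDiff 1 ((-1 : ℝ) • G) := (hGd.of_le (by omega)).smul _
  obtain ⟨c, hc⟩ := exists_const_of_pderiv_eq_zero (H := F + (-1 : ℝ) • G) (hd1.add hGd1)
    (fun q => by simp [hm q, hGm q]) (by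
      rw [pderiv_add hd1 hGd1, pderiv_smul (hGd.of_le (by omega)), hDFG]
      simp)
  have : F = G + c • (1 : PFun X) := by
    funext i t
    have := congrFun (congrFun hc i) t
    simp only [Pi.add_apply, Pi.smul_apply, smul_eq_mul, Pi.one_apply] at this ⊢
    linarith
  rw [this]
  exact Submodule.add_mem _ hG (Submodule.smul_mem _ _ hT.one_mem)

/-- The spaces of a chain of levels are characterized by the absence of jumps of all generalized
derivatives and by the constancy of the last one. -/
theorem mem_iff_chain {n : ℕ} (T : ℕ → ℕ → PFun X) (hT : IsTotallyPositiveLevel (n + 1) (T 0))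
    (hnext : ∀ j < n, T (j + 1) = levelNext (n + 1 - j) (T j))
    (hV : KnotConn (n + 1) (levelSpan (n + 1) (T 0) : Set (PFun X)))
    (H : ℕ → PFun X) (hd : PContDiff n (H 0))
    (hH : ∀ j < n, H (j + 1) = pderiv (H j) / levelWeight (n + 1 - j) (T j)) :
    H 0 ∈ levelSpan (n + 1) (T 0) ↔
      (∃ c : ℝ, ∀ i t, H n i t = c) ∧ ∀ j < n + 1, PMatch (H j) := by
  induction n generalizing T H with
  | zero =>
    rw [mem_levelSpan]
    simp only [Finset.Icc_self, Finset.sum_singleton, hT.one, zero_add]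
    constructor
    · rintro ⟨c, hc⟩
      have : ∀ i t, H 0 i t = c 1 := fun i t => by simp [← hc]
      refine ⟨⟨c 1, this⟩, fun j hj q => ?_⟩
      obtain rfl : j = 0 := by omega
      rw [this, this]
    · rintro ⟨⟨c, hc⟩, -⟩
      refine ⟨fun _ => c, ?_⟩
      funext i t
      simp [hc]
  | succ n ih =>
    have h1 := hnext 0 (by omega)
    have hH0 := hH 0 (by omega)
    simp only [zero_add, Nat.sub_zero] at h1 hH0
    have hT' : IsTotallyPositiveLevel (n + 1) (T 1) := h1 ▸ hT.next
    have hV' : KnotConn (n + 1) (levelSpan (n + 1) (T 1) : Set (PFun X)) :=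
      h1 ▸ hT.knotConn_next hV
    have hd' : PContDiff n (H 1) := by
      rw [hH0]
      exact hd.pderiv.div hT.contDiff_weight hT.weight_pos
    have hih := ih (fun j => T (j + 1)) hT' (fun j hj => by
        rw [hnext (j + 1) (by omega), show n + 1 + 1 - (j + 1) = n + 1 - j by omega])
      hV' (fun j => H (j + 1)) hd' (fun j hj => by
        rw [hH (j + 1) (by omega), show n + 1 + 1 - (j + 1) = n + 1 - j by omega])
    simp only [zero_add] at hih
    rw [hT.mem_iff_next hV hd, ← h1, ← hH0, hih]
    constructor
    · rintro ⟨h2, h3, h4⟩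
      refine ⟨h3, fun j hj => ?_⟩
      cases j with
      | zero => exact h2
      | succ j => exact h4 j (by omega)
    · rintro ⟨h3, h4⟩
      exact ⟨h4 0 (by omega), h3, fun j hj => h4 (j + 1) (by omega)⟩

end IsTotallyPositiveLevel

theorem transFam_isTotallyPositiveLevel {m : ℕ} {f : ℕ → PFun X}
    (hf : IsTotallyPositiveLevel m f) {j : ℕ} (hj : j < m) :
    IsTotallyPositiveLevel (m - j) (transFam m f j) := by
  induction j with
  | zero => exact hf
  | succ j ih =>
    have h := ih (by omega)
    obtain ⟨n, hn⟩ : ∃ n, m - j = n + 2 := ⟨m - j - 2, by omega⟩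
    rw [transFam_succ_eq, show m - (j + 1) = n + 1 by omega, hn]
    exact (hn ▸ h).next

theorem weight_pos_and_contDiff {m : ℕ} {f : ℕ → PFun X}
    (hf : IsTotallyPositiveLevel m f) {j : ℕ} (hj : j < m) :
    PPositive (weight m f j) ∧ PContDiff (m - j - 1) (weight m f j) := by
  cases j with
  | zero => exact ⟨fun _ _ => one_pos, pContDiff_const _ 1⟩
  | succ j =>
    have h := transFam_isTotallyPositiveLevel hf (j := j) (by omega)
    obtain ⟨n, hn⟩ : ∃ n, m - j = n + 2 := ⟨m - j - 2, by omega⟩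
    rw [weight_succ_eq, show m - (j + 1) - 1 = n by omega, hn]
    rw [hn] at h
    exact ⟨h.weight_pos, h.contDiff_weight⟩

/-- The weight functions of a totally positive level are associated with its span. -/
theorem isAssociated_levelSpan {m : ℕ} {f : ℕ → PFun X} (hm : 1 ≤ m)
    (hf : IsTotallyPositiveLevel m f) (hV : KnotConn m (levelSpan m f : Set (PFun X))) :
    IsAssociated m (weight m f) (levelSpan m f) := by
  obtain ⟨n, rfl⟩ := Nat.exists_eq_add_of_le' hm
  refine ⟨fun j hj => weight_pos_and_contDiff hf hj, ?_⟩
  have h0 : ∀ F : PFun X, genDeriv (weight (n + 1) f) 0 F = F := fun F => div_one F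
  have key : ∀ F : PFun X, PContDiff n F → (F ∈ levelSpan (n + 1) f ↔
      (∃ c : ℝ, ∀ i t, genDeriv (weight (n + 1) f) n F i t = c) ∧
        ∀ j < n + 1, PMatch (genDeriv (weight (n + 1) f) j F)) := fun F hF => by
    have := IsTotallyPositiveLevel.mem_iff_chain (transFam (n + 1) f) hf (fun j _ => rfl) hV
      (fun j => genDeriv (weight (n + 1) f) j F) (by rwa [h0]) fun j _ => rfl
    rwa [h0] at this
  ext F
  constructor
  · intro hF
    have hd := hf.contDiff_of_mem hF
    obtain ⟨h1, h2⟩ := (key F hd).1 hF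
    exact ⟨hd, h1, fun q j hj => h2 j hj q⟩
  · rintro ⟨hd, h1, h2⟩
    exact (key F hd).2 ⟨h1, fun j hj q => h2 q j hj⟩

/-- G is a derivative from the span exactly when G divided by the first nontrivial weight lies in
the next level, so the chain of levels is entered one step later. -/
theorem isAssociated_pderiv_levelSpan {m : ℕ} {f : ℕ → PFun X} (hm : 2 ≤ m)
    (hf : IsTotallyPositiveLevel m f) (hV : KnotConn m (levelSpan m f : Set (PFun X))) :
    IsAssociated (m - 1) (fun j => weight m f (j + 1))
      (pderiv '' (levelSpan m f : Set (PFun X))) := by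
  obtain ⟨n, rfl⟩ := Nat.exists_eq_add_of_le' hm
  rw [show n + 2 - 1 = n + 1 by omega]
  refine ⟨fun j hj => ?_, ?_⟩
  · have := weight_pos_and_contDiff hf (j := j + 1) (by omega)
    rwa [show n + 2 - (j + 1) - 1 = n + 1 - j - 1 by omega] at this
  have hmem : ∀ G : PFun X, G ∈ pderiv '' (levelSpan (n + 2) f : Set (PFun X)) ↔
      G / levelWeight (n + 2) f ∈ levelSpan (n + 1) (levelNext (n + 2) f) := by
    intro G
    constructor
    · rintro ⟨F, hF, rfl⟩
      exact hf.pderiv_div_mem hF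
    · intro hG
      obtain ⟨F, hF, hFG⟩ := hf.exists_pderiv_div_eq hG
      exact ⟨F, hF, (hf.weight_pos.eq_of_div_eq hFG).symm⟩
  have key : ∀ G : PFun X, PContDiff n G → (G ∈ pderiv '' (levelSpan (n + 2) f : Set (PFun X)) ↔
      (∃ c : ℝ, ∀ i t, genDeriv (fun j => weight (n + 2) f (j + 1)) n G i t = c) ∧
        ∀ j < n + 1, PMatch (genDeriv (fun j => weight (n + 2) f (j + 1)) j G)) := fun G hG => by
    rw [hmem]
    exact IsTotallyPositiveLevel.mem_iff_chain (fun j => transFam (n + 2) f (j + 1)) hf.next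
      (fun j _ => by
        rw [transFam_succ_eq _ _ (j + 1), show n + 2 - (j + 1) = n + 1 - j by omega])
      (hf.knotConn_next hV)
      (fun j => genDeriv (fun j => weight (n + 2) f (j + 1)) j G)
      (hG.div hf.contDiff_weight hf.weight_pos) fun j _ => by
        dsimp only [genDeriv]
        rw [weight_succ_eq _ _ (j + 1), show n + 2 - (j + 1) = n + 1 - j by omega]
  ext G
  constructor
  · intro hG
    have hd : PContDiff n G := by
      obtain ⟨F, hF, rfl⟩ := hG
      exact (hf.contDiff_of_mem hF).pderiv
    obtain ⟨h1, h2⟩ := (key G hd).1 hG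
    exact ⟨hd, h1, fun q j hj => h2 j hj q⟩
  · rintro ⟨hd, h1, h2⟩
    exact (key G hd).2 ⟨h1, fun j hj q => h2 q j hj⟩

end LevelSpaces

end PCSpline

namespace PCSpline

/-! ### Total positivity of the derivatives of the transition functions -/

section Initial

variable {k : ℕ} {X : Knots k}

/-- Passing to combinations whose derivatives left of the knot form the identity matrix, the
derivatives on the right form a lower triangular matrix with diagonal `ρ`. The two Wronskians differ
by the product of these positive entries. -/
theorem KnotConn.segWr_mul_pos {n : ℕ} {E : Submodule ℝ (PFun X)}
    (hE : KnotConn n (E : Set (PFun X))) (hd : ∀ F ∈ E, PContDiff (n - 1) F) {s : ℕ} (hs : s ≤ n)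
    {g : Fin s → PFun X} (hg : ∀ q, g q ∈ E) (l : Fin k)
    (h0 : segWr (fun q => g q l.castSucc) (X.right l.castSucc) ≠ 0) :
    0 < segWr (fun q => g q l.succ) (X.left l.succ) *
      segWr (fun q => g q l.castSucc) (X.right l.castSucc) := by
  obtain ⟨ρ, h1, h2⟩ := hE l
  set M : Matrix (Fin s) (Fin s) ℝ :=
    Matrix.of fun a q : Fin s => segDeriv^[(a : ℕ)] (g q l.castSucc) (X.right l.castSucc) with hM
  set M' : Matrix (Fin s) (Fin s) ℝ :=
    Matrix.of fun a q : Fin s => segDeriv^[(a : ℕ)] (g q l.succ) (X.left l.succ) with hM'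
  have hunit : IsUnit M.det := isUnit_iff_ne_zero.2 h0
  let G : Fin s → PFun X := fun b => ∑ q, M⁻¹ q b • g q
  have hG : ∀ b, G b ∈ E := fun b => Submodule.sum_mem _ fun q _ => E.smul_mem _ (hg q)
  have hGi : ∀ b i, G b i = ∑ q, M⁻¹ q b • g q i := fun b i => by
    simp [G, Finset.sum_apply]
  have e1 : ∀ a b : Fin s, segDeriv^[(a : ℕ)] (G b l.castSucc) (X.right l.castSucc) =
      (1 : Matrix (Fin s) (Fin s) ℝ) a b := by
    intro a b
    rw [hGi, segDeriv_iterate_sum_smul (X.seg_lt _)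
      fun q _ => (hd _ (hg q) _).of_le (by omega), ← Matrix.mul_nonsing_inv M hunit,
      Matrix.mul_apply]
    exact Finset.sum_congr rfl fun q _ => mul_comm _ _
  have e2 : ∀ a b : Fin s, segDeriv^[(a : ℕ)] (G b l.succ) (X.left l.succ) =
      (M' * M⁻¹) a b := by
    intro a b
    rw [hGi, segDeriv_iterate_sum_smul (X.seg_lt _)
      fun q _ => (hd _ (hg q) _).of_le (by omega), Matrix.mul_apply]
    exact Finset.sum_congr rfl fun q _ => mul_comm _ _
  have e3 : ∀ b : Fin s, ∀ c < (b : ℕ),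
      segDeriv^[c] (G b l.castSucc) (X.right l.castSucc) = 0 := by
    intro b c hc
    have := e1 ⟨c, hc.trans b.2⟩ b
    rwa [Matrix.one_apply_ne (fun h => hc.ne (congrArg Fin.val h))] at this
  have htri : (M' * M⁻¹).IsLowerTriangular := by
    intro a b hab
    have hab' : (a : ℕ) < b := by simpa using hab
    rw [← e2]
    exact hE.left_of_right (hG b) (r := b) (by omega) (e3 b) a hab'
  have hdiag : ∀ b, (M' * M⁻¹) b b = ρ b := by
    intro b
    rw [← e2, h2 _ (hG b) b (by omega) (e3 b), e1, Matrix.one_apply_eq, mul_one]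
  have hdet : M'.det = (∏ b : Fin s, ρ b) * M.det := by
    have h3 := Matrix.det_of_isLowerTriangular _ htri
    simp only [hdiag] at h3
    rw [← h3, Matrix.det_mul, mul_assoc, ← Matrix.det_mul, Matrix.nonsing_inv_mul M hunit,
      Matrix.det_one, mul_one]
  change 0 < M'.det * M.det
  rw [hdet, mul_assoc]
  exact mul_pos (Finset.prod_pos fun b _ => h1 b) (mul_self_pos.2 h0)

/-- The properties of transition functions that matter for the space `E` of derivatives, of
dimension `n`. -/
structure IsTransitionFor (n : ℕ) (E : Submodule ℝ (PFun X)) (f : ℕ → PFun X) : Prop where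
  one : f 1 = 1
  contDiff : ∀ l ∈ Finset.Icc 1 (n + 1), PContDiff n (f l)
  noJump : ∀ l ∈ Finset.Icc 1 (n + 1), PMatch (f l)
  mem : ∀ l ∈ Finset.Icc 2 (n + 1), pderiv (f l) ∈ E
  left_zero : ∀ l ∈ Finset.Icc 2 (n + 1), ∀ s < l - 2,
    segDeriv^[s] (pderiv (f l) 0) (X.left 0) = 0
  right_zero : ∀ l ∈ Finset.Icc 2 (n + 1), ∀ s < n + 1 - l,
    segDeriv^[s] (pderiv (f l) (Fin.last k)) (X.right (Fin.last k)) = 0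
  left_val : ∀ l ∈ Finset.Icc 2 (n + 1), f l 0 (X.left 0) = 0
  right_val : ∀ l ∈ Finset.Icc 2 (n + 1), f l (Fin.last k) (X.right (Fin.last k)) = 1

namespace IsTransitionFor

variable {n : ℕ} {E : Submodule ℝ (PFun X)} {f : ℕ → PFun X}

theorem combination_mem (hf : IsTransitionFor n E f) {r : ℕ} {J : Fin r → ℕ}
    (hJ : ∀ q, 2 ≤ J q ∧ J q ≤ n + 1) (x : Fin r → ℝ) :
    ∑ q, x q • pderiv (f (J q)) ∈ E :=
  Submodule.sum_mem _ fun q _ => E.smul_mem _ (hf.mem _ (Finset.mem_Icc.2 (hJ q)))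

theorem iterate_combination (hE : IsECPSpace n (E : Set (PFun X))) (hf : IsTransitionFor n E f)
    {r : ℕ} {J : Fin r → ℕ} (hJ : ∀ q, 2 ≤ J q ∧ J q ≤ n + 1) (x : Fin r → ℝ) {a : ℕ}
    (ha : a ≤ n - 1) (i : Fin (k + 1)) (t : X.Seg i) :
    segDeriv^[a] ((∑ q, x q • pderiv (f (J q))) i) t =
      ∑ q, x q * segDeriv^[a] (pderiv (f (J q)) i) t := by
  have h := segDeriv_iterate_sum_smul (X.seg_lt i) (s := Finset.univ)
    (f := fun q => pderiv (f (J q)) i)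
    (fun q _ => (hE.contDiff _ (hf.mem _ (Finset.mem_Icc.2 (hJ q))) i).of_le ha) x t
  rw [← h, Finset.sum_apply]
  rfl

theorem pvanish_left (hK : KnotConn n (E : Set (PFun X))) {F : PFun X} (hF : F ∈ E) {r : ℕ}
    (hr : r ≤ n) (h : ∀ s < r, segDeriv^[s] (F 0) (X.left 0) = 0) : PVanish F (X.pt 0) r :=
  hK.pvanish hF hr (i := 0) (t := X.left 0) h

theorem pvanish_right (hK : KnotConn n (E : Set (PFun X))) {F : PFun X} (hF : F ∈ E) {r : ℕ}
    (hr : r ≤ n) (h : ∀ s < r, segDeriv^[s] (F (Fin.last k)) (X.right (Fin.last k)) = 0) :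
    PVanish F (X.pt (Fin.last (k + 1))) r :=
  hK.pvanish hF hr (i := Fin.last k) (t := X.right (Fin.last k)) h

theorem pderiv_ne_zero (hE : IsECPSpace n (E : Set (PFun X))) (hf : IsTransitionFor n E f)
    {l : ℕ} (hl : l ∈ Finset.Icc 2 (n + 1)) : pderiv (f l) ≠ 0 := by
  intro h0
  have hl' := Finset.mem_Icc.1 hl
  have hl1 : l ∈ Finset.Icc 1 (n + 1) := Finset.mem_Icc.2 ⟨by omega, hl'.2⟩
  obtain ⟨c, hc⟩ := exists_const_of_pderiv_eq_zero
    ((hf.contDiff l hl1).of_le hE.one_le) (hf.noJump l hl1) h0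
  have h1 := hf.left_val l hl
  have h2 := hf.right_val l hl
  rw [hc] at h1 h2
  exact zero_ne_one (h1.symm.trans h2)

/-- One more vanishing derivative at a, with the n + 1 - l zeros at b, would make n zeros. -/
theorem left_coeff_ne_zero (hE : IsECPSpace n (E : Set (PFun X)))
    (hK : KnotConn n (E : Set (PFun X))) (hf : IsTransitionFor n E f) {l : ℕ}
    (hl : l ∈ Finset.Icc 2 (n + 1)) : segDeriv^[l - 2] (pderiv (f l) 0) (X.left 0) ≠ 0 := by
  intro h0
  have hl' := Finset.mem_Icc.1 hl
  obtain ⟨t, h1, h2⟩ := exists_between X.first_lt_last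
  refine hf.pderiv_ne_zero hE hl (hE.eq_zero_of_three (hf.mem l hl) h1 h2 (p := l - 1) (q := 0)
    (s := n + 1 - l) (pvanish_left hK (hf.mem l hl) (by omega) fun s hs => ?_)
    (fun s hs => by omega)
    (pvanish_right hK (hf.mem l hl) (by omega) (hf.right_zero l hl)) (by omega))
  rcases Nat.lt_or_ge s (l - 2) with h | h
  · exact hf.left_zero l hl s h
  · rwa [show s = l - 2 by omega]

theorem exists_segWr_sign_first (hE : IsECPSpace n (E : Set (PFun X)))
    (hK : KnotConn n (E : Set (PFun X))) (hf : IsTransitionFor n E f) {r : ℕ} {J : Fin r → ℕ}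
    (hJ : StrictMono J) (hmem : ∀ q, 2 ≤ J q ∧ J q ≤ n + 1) :
    ∃ t : X.Seg 0, X.pt 0 < t ∧ (t : ℝ) < X.pt (Fin.succ 0) ∧
      0 < (∏ q, segDeriv^[J q - 2] (pderiv (f (J q)) 0) (X.left 0)) *
        segWr (fun q => pderiv (f (J q)) 0) t := by
  have hr := card_le_of_strictMono hJ hmem
  refine exists_segWr_sign (X.seg_lt 0) (M := n - 1) (by omega)
    (fun q => hE.contDiff _ (hf.mem _ (Finset.mem_Icc.2 (hmem q))) 0) (p := fun q => J q - 2)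
    (fun a b hab => ?_) (fun q => ?_) (fun q => hf.left_zero _ (Finset.mem_Icc.2 (hmem q)))
    fun q => hf.left_coeff_ne_zero hE hK (Finset.mem_Icc.2 (hmem q))
  · have := hJ hab
    have := (hmem a).1
    dsimp only
    omega
  · have := hmem q
    omega

/-- The Wronskian is nonzero at some point near a, because the orders of vanishing there are
distinct. -/
theorem combination_eq_zero (hE : IsECPSpace n (E : Set (PFun X)))
    (hK : KnotConn n (E : Set (PFun X))) (hf : IsTransitionFor n E f) {r : ℕ} {J : Fin r → ℕ}
    (hJ : StrictMono J) (hmem : ∀ q, 2 ≤ J q ∧ J q ≤ n + 1) (hr : r ≤ n) {x : Fin r → ℝ}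
    (hx : ∑ q, x q • pderiv (f (J q)) = 0) : x = 0 := by
  obtain ⟨t, -, -, h⟩ := hf.exists_segWr_sign_first hE hK hJ hmem
  refine eq_zero_of_segWr_ne_zero (right_ne_zero_of_mul h.ne') fun a ha => ?_
  rw [← hf.iterate_combination hE hmem x (by omega), hx]
  exact congrFun (segDeriv_iterate_zero (X.seg_lt 0) a) t

/-- For consecutive indices every combination has p - 2 zeros at a and n + 2 - (p + r) at b. An
r-fold interior zero completes the count to exactly n. -/
theorem segWr_consecutive_ne_zero (hE : IsECPSpace n (E : Set (PFun X)))
    (hK : KnotConn n (E : Set (PFun X))) (hf : IsTransitionFor n E f) {r p : ℕ} (hp : 2 ≤ p)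
    (hr : p + r ≤ n + 2) {i : Fin (k + 1)} {t : X.Seg i} (h1 : X.pt 0 < t)
    (h2 : t < X.pt (Fin.last (k + 1))) :
    segWr (fun q : Fin r => pderiv (f (p + q)) i) t ≠ 0 := by
  intro h0
  have hmem : ∀ q : Fin r, 2 ≤ p + (q : ℕ) ∧ p + (q : ℕ) ≤ n + 1 := fun q => by omega
  have hJ : StrictMono fun q : Fin r => p + (q : ℕ) := fun a b hab => by
    have : (a : ℕ) < b := hab
    simpa using this
  obtain ⟨x, hx0, hx⟩ := exists_combination_of_segWr_eq_zero h0
  have hF := hf.combination_mem hmem x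
  refine hx0 (hf.combination_eq_zero hE hK hJ hmem (by omega)
    (hE.eq_zero_of_three hF h1 h2 (p := p - 2) (q := r) (s := n + 2 - (p + r))
      (pvanish_left hK hF (by omega) fun s hs => ?_)
      (hK.pvanish hF (by omega) fun s hs => ?_)
      (pvanish_right hK hF (by omega) fun s hs => ?_) (by omega)))
  · rw [hf.iterate_combination hE hmem x (by omega)]
    refine Finset.sum_eq_zero fun q _ => ?_
    rw [hf.left_zero _ (Finset.mem_Icc.2 (hmem q)) s (by omega), mul_zero]
  · rw [hf.iterate_combination hE hmem x (by omega)]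
    exact hx s hs
  · rw [hf.iterate_combination hE hmem x (by omega)]
    refine Finset.sum_eq_zero fun q _ => ?_
    rw [hf.right_zero _ (Finset.mem_Icc.2 (hmem q)) s (by omega), mul_zero]

theorem segWr_consecutive_sign (hE : IsECPSpace n (E : Set (PFun X)))
    (hK : KnotConn n (E : Set (PFun X))) (hf : IsTransitionFor n E f) {r p : ℕ} (hp : 2 ≤ p)
    (hr : p + r ≤ n + 2) :
    (∀ i (t : X.Seg i), X.pt 0 < t → t < X.pt (Fin.last (k + 1)) →
        0 < segWr (fun q : Fin r => pderiv (f (p + q)) i) t) ∨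
      ∀ i (t : X.Seg i), X.pt 0 < t → t < X.pt (Fin.last (k + 1)) →
        segWr (fun q : Fin r => pderiv (f (p + q)) i) t < 0 := by
  have hmem : ∀ q : Fin r, p + (q : ℕ) ∈ Finset.Icc 2 (n + 1) := fun q =>
    Finset.mem_Icc.2 (by omega)
  refine sign_const (Q := fun i t => segWr (fun q : Fin r => pderiv (f (p + q)) i) t)
    (fun i => continuous_segWr (X.seg_lt i) fun q =>
      (hE.contDiff _ (hf.mem _ (hmem q)) i).of_le (by omega)) le_rfl le_rfl
    (fun i t h1 h2 => hf.segWr_consecutive_ne_zero hE hK hp hr h1 h2) fun l h1 h2 => ?_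
  exact hK.segWr_mul_pos hE.contDiff (by omega) (g := fun q : Fin r => pderiv (f (p + q)))
    (fun q => hf.mem _ (hmem q)) l (hf.segWr_consecutive_ne_zero hE hK hp hr h1 h2)

/-- Inside, the derivative of f_l has constant sign. That sign is positive since f_l rises from 0 to
1, and it agrees with the sign of the leading coefficient at a. -/
theorem left_coeff_pos (hE : IsECPSpace n (E : Set (PFun X)))
    (hK : KnotConn n (E : Set (PFun X))) (hf : IsTransitionFor n E f) {l : ℕ}
    (hl : l ∈ Finset.Icc 2 (n + 1)) : 0 < segDeriv^[l - 2] (pderiv (f l) 0) (X.left 0) := by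
  have hl' := Finset.mem_Icc.1 hl
  have hl1 : l ∈ Finset.Icc 1 (n + 1) := Finset.mem_Icc.2 ⟨by omega, hl'.2⟩
  have hd1 : PContDiff 1 (f l) := (hf.contDiff l hl1).of_le hE.one_le
  have hwr : ∀ i (t : X.Seg i), segWr (fun q : Fin 1 => pderiv (f (l + q)) i) t =
      pderiv (f l) i t := fun i t => by simp [segWr]
  have hlt : (X.left 0 : ℝ) < X.right (Fin.last k) := X.first_lt_last
  rcases hf.segWr_consecutive_sign hE hK (r := 1) hl'.1 (by omega) with h | h
  · obtain ⟨t, h1, h2, h3⟩ := hf.exists_segWr_sign_first hE hK (J := fun q : Fin 1 => l + (q : ℕ))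
      (Subsingleton.strictMono _) fun q => by omega
    have h4 := h 0 t h1 (h2.trans_le (X.strictMono.monotone (Fin.le_last _)))
    have h5 := (pos_iff_pos_of_mul_pos h3).2 h4
    simpa using h5
  · exfalso
    have hneg : pderiv ((-1 : ℝ) • f l) = (-1 : ℝ) • pderiv (f l) := pderiv_smul hd1 _
    have := lt_of_pderiv_pos (hd1.smul (-1)) (fun q => by simp [hf.noJump l hl1 q])
      (p := X.pt 0) (q := X.pt (Fin.last (k + 1))) (fun i t h1 h2 => by
        have := h i t h1 h2
        rw [hwr] at this
        rw [hneg]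
        simpa using this) (X.left 0) (X.right (Fin.last k)) le_rfl hlt le_rfl
    simp only [Pi.smul_apply, hf.left_val l hl, hf.right_val l hl, smul_eq_mul] at this
    linarith

theorem segWr_consecutive_pos (hE : IsECPSpace n (E : Set (PFun X)))
    (hK : KnotConn n (E : Set (PFun X))) (hf : IsTransitionFor n E f) {r p : ℕ} (hp : 2 ≤ p)
    (hr : p + r ≤ n + 2) {i : Fin (k + 1)} {t : X.Seg i} (h1 : X.pt 0 < t)
    (h2 : t < X.pt (Fin.last (k + 1))) :
    0 < segWr (fun q : Fin r => pderiv (f (p + q)) i) t := by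
  rcases hf.segWr_consecutive_sign hE hK hp hr with h | h
  · exact h i t h1 h2
  · have hmem : ∀ q : Fin r, 2 ≤ p + (q : ℕ) ∧ p + (q : ℕ) ≤ n + 1 := fun q => by omega
    obtain ⟨s, h3, h4, h5⟩ := hf.exists_segWr_sign_first hE hK
      (J := fun q : Fin r => p + (q : ℕ)) (fun a b hab => by
        have : (a : ℕ) < b := hab
        simpa using this) hmem
    have h6 := (pos_iff_pos_of_mul_pos h5).1
      (Finset.prod_pos fun q _ => hf.left_coeff_pos hE hK (Finset.mem_Icc.2 (hmem q)))
    exact absurd (h 0 s h3 (h4.trans_le (X.strictMono.monotone (Fin.le_last _))))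
      (not_lt.2 h6.le)

/-- The derivatives of the transition functions have nonnegative Wronskians. -/
theorem isTotallyPositiveLevel (hE : IsECPSpace n (E : Set (PFun X)))
    (hK : KnotConn n (E : Set (PFun X))) (hf : IsTransitionFor n E f) :
    IsTotallyPositiveLevel (n + 1) f := by
  have hnn : ∀ (r : ℕ) (J : Fin r → ℕ), StrictMono J → (∀ q, 2 ≤ J q ∧ J q ≤ n + 1) →
      ∀ i t, 0 ≤ segWr (fun q => pderiv (f (J q)) i) t := by
    intro r J hJ hmem i
    have hr := card_le_of_strictMono hJ hmem
    refine nonneg_of_nonneg_interior (X.seg_lt i) (continuous_segWr (X.seg_lt i) fun q =>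
      (hE.contDiff _ (hf.mem _ (Finset.mem_Icc.2 (hmem q))) i).of_le (by omega)) fun t h1 h2 => ?_
    have h3 : X.pt 0 < t := (X.strictMono.monotone (Fin.zero_le _)).trans_lt h1
    have h4 : t < X.pt (Fin.last (k + 1)) := h2.trans_le (X.strictMono.monotone (Fin.le_last _))
    -- Fekete's criterion applied pointwise to the matrix of derivatives at an interior point `t`.
    exact (initialMinor_pos_of_consecutive (fun h a => segDeriv^[a] (pderiv (f h) i) t) 2 (n + 1)
      (fun r p hp hr => hf.segWr_consecutive_pos hE hK hp (by omega) h3 h4) r J hJ hmem).le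
  refine ⟨hf.one, hf.contDiff, hnn, fun r J hJ hmem hr i t => ?_⟩
  obtain rfl : r = n := by omega
  refine lt_of_le_of_ne (hnn r J hJ hmem i t) fun h0 => ?_
  -- Strictness, also at the end points: a singular full Wronskian would give a nonzero element of
  -- `E` with a zero of multiplicity equal to the dimension.
  obtain ⟨x, hx0, hx⟩ := exists_combination_of_segWr_eq_zero h0.symm
  have hF := hf.combination_mem hmem x
  refine hx0 (hf.combination_eq_zero hE hK hJ hmem le_rfl (hE.eq_zero_of_pvanish hF
    (X.mem_range t) (hK.pvanish hF le_rfl fun s hs => ?_)))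
  rw [hf.iterate_combination hE hmem x (by omega)]
  exact hx s hs

end IsTransitionFor

end Initial

end PCSpline

namespace PCSpline

/-! ### Dimension and knot conditions of the spline space -/

section Splines

variable {k m : ℕ} {X : Knots k}

theorem jet_add {c d : ℝ} (hcd : c < d) {f g : Set.Icc c d → ℝ} (hf : SegContDiff (m - 1) f)
    (hg : SegContDiff (m - 1) g) (t : Set.Icc c d) : jet m (f + g) t = jet m f t + jet m g t := by
  funext r
  simp only [jet, Pi.add_apply]
  rw [segDeriv_iterate_add hcd (hf.of_le (by omega)) (hg.of_le (by omega))]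
  rfl

theorem jet_smul {c d : ℝ} (hcd : c < d) {f : Set.Icc c d → ℝ} (hf : SegContDiff (m - 1) f)
    (a : ℝ) (t : Set.Icc c d) : jet m (a • f) t = a • jet m f t := by
  funext r
  simp only [jet, Pi.smul_apply]
  rw [segDeriv_iterate_smul hcd (hf.of_le (by omega))]
  rfl

theorem jet_zero {c d : ℝ} (hcd : c < d) (t : Set.Icc c d) :
    jet m (0 : Set.Icc c d → ℝ) t = 0 := by
  funext r
  exact congrFun (segDeriv_iterate_zero hcd r) t

theorem IsECSpace.eq_zero_of_jet_eq_zero {c d : ℝ} {U : Submodule ℝ (Set.Icc c d → ℝ)}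
    (hU : IsECSpace m U) {f : Set.Icc c d → ℝ} (hf : f ∈ U) {t : Set.Icc c d}
    (h : jet m f t = 0) : f = 0 := by
  classical
  by_contra hne
  have h1 : m ≤ segZeroMult m f t :=
    Nat.le_findGreatest le_rfl fun s hs => congrFun h ⟨s, hs⟩
  have h2 : ((∑ s ∈ ({t} : Finset (Set.Icc c d)), segZeroMult m f s : ℕ) : ℕ∞) ≤
      segNumZeros m f :=
    le_iSup (fun T : Finset (Set.Icc c d) => ((∑ s ∈ T, segZeroMult m f s : ℕ) : ℕ∞)) {t}
  have h3 := h2.trans (hU.numZeros_le f hf hne)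
  rw [Finset.sum_singleton] at h3
  have h4 : segZeroMult m f t ≤ m - 1 := by exact_mod_cast h3
  have := hU.one_le
  omega

theorem IsECSpace.exists_jet_eq {c d : ℝ} (hcd : c < d) {U : Submodule ℝ (Set.Icc c d → ℝ)}
    (hU : IsECSpace m U) (t : Set.Icc c d) (y : Fin m → ℝ) : ∃ f ∈ U, jet m f t = y := by
  let Φ : U →ₗ[ℝ] (Fin m → ℝ) :=
    { toFun := fun f => jet m (f : Set.Icc c d → ℝ) t
      map_add' := fun f g => jet_add hcd (hU.contDiff f f.2) (hU.contDiff g g.2) t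
      map_smul' := fun a f => jet_smul hcd (hU.contDiff f f.2) a t }
  have hpos : 0 < Module.finrank ℝ U := by
    rw [hU.finrank_eq]
    exact hU.one_le
  have : FiniteDimensional ℝ U := Module.finite_of_finrank_pos hpos
  have hinj : Function.Injective Φ := by
    rw [injective_iff_map_eq_zero]
    exact fun f hf => Subtype.ext (hU.eq_zero_of_jet_eq_zero f.2 hf)
  obtain ⟨f, hf⟩ := (LinearMap.injective_iff_surjective_of_finrank_eq_finrank (f := Φ)
    (by rw [hU.finrank_eq, Module.finrank_fin_fun])).1 hinj y
  exact ⟨f, f.2, hf⟩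

/-- The spline space as a linear subspace. -/
def splineSubmodule (X : Knots k) (U : (i : Fin (k + 1)) → Submodule ℝ (X.Seg i → ℝ))
    (R : Fin k → Matrix (Fin m) (Fin m) ℝ) : Submodule ℝ (PFun X) where
  carrier := splineSpace X U R
  zero_mem' := ⟨pContDiff_const _ 0, fun i => (U i).zero_mem, fun q => by
    simp only [Pi.zero_apply]
    rw [jet_zero (X.seg_lt _), jet_zero (X.seg_lt _), Matrix.mulVec_zero]⟩
  add_mem' := fun {F G} hF hG => ⟨hF.1.add hG.1, fun i => (U i).add_mem (hF.2.1 i) (hG.2.1 i),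
    fun q => by
      simp only [Pi.add_apply]
      rw [jet_add (X.seg_lt _) (hF.1 _) (hG.1 _), jet_add (X.seg_lt _) (hF.1 _) (hG.1 _),
        hF.2.2, hG.2.2, Matrix.mulVec_add]⟩
  smul_mem' := fun a F hF => ⟨hF.1.smul a, fun i => (U i).smul_mem a (hF.2.1 i), fun q => by
      simp only [Pi.smul_apply]
      rw [jet_smul (X.seg_lt _) (hF.1 _), jet_smul (X.seg_lt _) (hF.1 _), hF.2.2,
        Matrix.mulVec_smul]⟩

variable {U : (i : Fin (k + 1)) → Submodule ℝ (X.Seg i → ℝ)}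
  {R : Fin k → Matrix (Fin m) (Fin m) ℝ}

theorem knotConn_splineSubmodule (hR : ∀ i, IsConnectionMatrix (R i)) :
    KnotConn m (splineSubmodule X U R : Set (PFun X)) := by
  intro q
  -- The factors are the diagonal entries of the connection matrix; the value 1 beyond its size only
  -- serves positivity.
  refine ⟨fun r => if h : r < m then R q ⟨r, h⟩ ⟨r, h⟩ else 1, fun r => ?_, ?_⟩
  · beta_reduce
    split_ifs
    · exact (hR q).diag_pos _
    · exact one_pos
  · intro F hF r hr h
    beta_reduce
    have hj := congrFun (hF.2.2 q) ⟨r, hr⟩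
    rw [Matrix.mulVec, dotProduct, Finset.sum_eq_single ⟨r, hr⟩] at hj
    · rw [dif_pos hr]
      exact hj
    · intro c _ hc
      rcases lt_or_gt_of_ne hc with hlt | hlt
      · rw [show jet m (F q.castSucc) (X.right q.castSucc) c = 0 from h c hlt, mul_zero]
      · rw [(hR q).lower _ _ hlt, zero_mul]
    · exact fun h => absurd (Finset.mem_univ _) h

/-- The derivatives at the left end point determine a spline, and they can be prescribed. -/
noncomputable def splineJetEquiv (hU : ∀ i, IsECSpace m (U i)) :
    splineSubmodule X U R ≃ₗ[ℝ] (Fin m → ℝ) := by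
  let Φ : splineSubmodule X U R →ₗ[ℝ] (Fin m → ℝ) :=
    { toFun := fun F => jet m ((F : PFun X) 0) (X.left 0)
      map_add' := fun F G => jet_add (X.seg_lt 0) (F.2.1 0) (G.2.1 0) _
      map_smul' := fun a F => jet_smul (X.seg_lt 0) (F.2.1 0) a _ }
  refine LinearEquiv.ofBijective Φ ⟨?_, fun y => ?_⟩
  · rw [injective_iff_map_eq_zero]
    rintro ⟨F, hF⟩ h
    refine Subtype.ext (funext fun i => ?_)
    change F i = 0
    induction i using Fin.induction with
    | zero => exact (hU 0).eq_zero_of_jet_eq_zero (hF.2.1 0) h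
    | succ i ih =>
      refine (hU i.succ).eq_zero_of_jet_eq_zero (hF.2.1 _) (t := X.left i.succ) ?_
      rw [hF.2.2, ih, jet_zero (X.seg_lt _), Matrix.mulVec_zero]
  · choose e he1 he2 using fun i => (hU i).exists_jet_eq (X.seg_lt i) (X.left i)
    -- The initial data on each segment, obtained by pushing the derivatives of the previous piece
    -- through the connection matrix.
    let Y : Fin (k + 1) → Fin m → ℝ := fun i => Fin.induction (motive := fun _ => Fin m → ℝ) y
      (fun q z => (R q).mulVec (jet m (e q.castSucc z) (X.right q.castSucc))) i
    have hY : ∀ q : Fin k, Y q.succ =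
        (R q).mulVec (jet m (e q.castSucc (Y q.castSucc)) (X.right q.castSucc)) := fun q =>
      Fin.induction_succ _ _ _
    refine ⟨⟨fun i => e i (Y i), fun i => (hU i).contDiff _ (he1 i _), fun i => he1 i _,
      fun q => ?_⟩, ?_⟩
    · rw [he2, hY]
    · exact he2 0 _

theorem finrank_splineSubmodule (hU : ∀ i, IsECSpace m (U i)) :
    Module.finrank ℝ (splineSubmodule X U R) = m := by
  rw [(splineJetEquiv hU).finrank_eq, Module.finrank_fin_fun]

theorem finite_splineSubmodule (hU : ∀ i, IsECSpace m (U i)) :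
    Module.Finite ℝ (splineSubmodule X U R) :=
  Module.Finite.equiv (splineJetEquiv hU).symm

end Splines

/-! ### Derivative spaces and zero counts from weight functions -/

section DerivativeSpaces

variable {k : ℕ} {X : Knots k}

/-- Differentiation on a space of piecewise `C^1` functions. -/
noncomputable def pderivLinear (V : Submodule ℝ (PFun X)) (hV : ∀ F ∈ V, PContDiff 1 F) : V →ₗ[ℝ] PFun X where
  toFun F := pderiv (F : PFun X)
  map_add' F G := pderiv_add (hV F F.2) (hV G G.2)
  map_smul' c F := pderiv_smul (hV F F.2) c

theorem coe_range_pderivLinear (V : Submodule ℝ (PFun X)) (hV : ∀ F ∈ V, PContDiff 1 F) :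
    (LinearMap.range (pderivLinear V hV) : Set (PFun X)) = pderiv '' (V : Set (PFun X)) := by
  ext G
  constructor
  · rintro ⟨F, rfl⟩
    exact ⟨F, F.2, rfl⟩
  · rintro ⟨F, hF, rfl⟩
    exact ⟨⟨F, hF⟩, rfl⟩

/-- Rank-nullity: without jumps, the kernel of differentiation is exactly the line of constants. -/
theorem finrank_range_pderivLinear (V : Submodule ℝ (PFun X)) [Module.Finite ℝ V]
    (hV : ∀ F ∈ V, PContDiff 1 F) (hone : (1 : PFun X) ∈ V) (hm : ∀ F ∈ V, PMatch F) :
    Module.finrank ℝ (LinearMap.range (pderivLinear V hV)) + 1 = Module.finrank ℝ V := by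
  rw [← LinearMap.finrank_range_add_finrank_ker (pderivLinear V hV)]
  congr 1
  have hne : (⟨1, hone⟩ : V) ≠ 0 := fun h => by
    have := congrFun (congrFun (congrArg Subtype.val h) 0) (X.left 0)
    exact one_ne_zero this
  have hker : LinearMap.ker (pderivLinear V hV) = Submodule.span ℝ {(⟨1, hone⟩ : V)} := by
    ext F
    rw [LinearMap.mem_ker, Submodule.mem_span_singleton]
    constructor
    · intro h
      obtain ⟨c, hc⟩ := exists_const_of_pderiv_eq_zero (hV F F.2) (hm F F.2) h
      refine ⟨c, Subtype.ext ?_⟩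
      rw [hc]
      funext i t
      simp
    · rintro ⟨c, rfl⟩
      rw [map_smul, show pderivLinear V hV ⟨1, hone⟩ = 0 from pderiv_const 1, smul_zero]
  rw [hker, finrank_span_singleton hne]

theorem numZeros_const {n : ℕ} {c : ℝ} (hc : c ≠ 0) :
    numZeros n (fun _ _ => c : PFun X) = 0 := by
  refine le_antisymm (iSup_le fun T => ?_) (zero_le)
  rw [Finset.sum_eq_zero]
  · simp
  · intro t _
    by_contra h
    obtain ⟨i, hi⟩ := X.exists_seg t.2
    exact hc ((pvanish_zeroMult n (fun _ _ => c : PFun X) t) 0 (Nat.pos_of_ne_zero h) i hi)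

theorem numZeros_succ_le_of_pderiv {H : PFun X} (h1 : PContDiff 1 H) (hm : PMatch H)
    (hρ : ∀ q : Fin k, ∃ ρ : ℝ, 0 < ρ ∧ pderiv H q.succ (X.left q.succ) =
      ρ * pderiv H q.castSucc (X.right q.castSucc)) (h0 : H ≠ 0) {n : ℕ}
    (hD : pderiv H ≠ 0 → numZeros (n + 1) (pderiv H) ≤ (n : ℕ∞)) :
    numZeros (n + 2) H ≤ ((n + 1 : ℕ) : ℕ∞) := by
  by_cases h : pderiv H = 0
  · obtain ⟨c, rfl⟩ := exists_const_of_pderiv_eq_zero h1 hm h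
    have hc : c ≠ 0 := fun hc => h0 (by rw [hc]; rfl)
    rw [numZeros_const hc]
    exact zero_le
  · refine (numZeros_succ_le h1 hm hρ (by omega)).trans ?_
    push_cast
    gcongr
    exact hD h

theorem numZeros_mul_le {n : ℕ} {w F : PFun X} (h0 : PPositive w) (hw : PContDiff n w)
    (hF : PContDiff n F) : numZeros (n + 1) (w * F) ≤ numZeros (n + 1) F := by
  refine iSup_le fun T => le_trans ?_ (sum_zeroMult_le_numZeros (n + 1) F T)
  have hle : ∀ t ∈ T, zeroMult (n + 1) (w * F) t ≤ zeroMult (n + 1) F t := by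
    intro t _
    refine PVanish.le_zeroMult (fun s hs i hi => ?_) (zeroMult_le _ _ _)
    have h := pvanish_zeroMult (n + 1) (w * F) t
    exact (vanish_mul_iff (X.seg_lt i) (hw i) (hF i) (zeroMult_le _ _ _)
      (h0 i ⟨t, hi⟩).ne').1 (fun s hs => h s hs i hi) s hs
  exact_mod_cast Finset.sum_le_sum hle

theorem contDiff_genDeriv {m : ℕ} {v : ℕ → PFun X} (hv : IsWeightSystem m v) {F : PFun X}
    (hF : PContDiff (m - 1) F) {j : ℕ} (hj : j < m) : PContDiff (m - 1 - j) (genDeriv v j F) := by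
  induction j with
  | zero => exact hF.div (hv 0 hj).2 (hv 0 hj).1
  | succ j ih =>
    have h := ih (by omega)
    have h2 := (hv (j + 1) hj).2
    rw [show m - (j + 1) - 1 = m - 1 - (j + 1) by omega] at h2
    refine PContDiff.div (PContDiff.pderiv ?_) h2 (hv (j + 1) hj).1
    rwa [show m - 1 - (j + 1) + 1 = m - 1 - j by omega]

/-- Induction backwards from the constant last generalized derivative: multiplying by a positive
weight creates no zeros, and Rolle's theorem costs one per step. -/
theorem numZeros_genDeriv_le {m : ℕ} {v : ℕ → PFun X} (hv : IsWeightSystem m v) {F : PFun X}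
    (hF : F ∈ ecpSet m v) (n j : ℕ) (hj : n + j + 1 = m) (h0 : genDeriv v j F ≠ 0) :
    numZeros (n + 1) (genDeriv v j F) ≤ (n : ℕ∞) := by
  induction n generalizing j with
  | zero =>
    obtain ⟨c, hc⟩ := hF.2.1
    have hj' : genDeriv v j F = fun _ _ => c := by
      funext i t
      rw [← hc i t, show m - 1 = j by omega]
    have hc0 : c ≠ 0 := fun h => h0 (by rw [hj', h]; rfl)
    rw [hj', numZeros_const hc0]
    exact zero_le
  | succ n ih =>
    have hd := contDiff_genDeriv hv hF.1 (j := j) (by omega)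
    have hd' := contDiff_genDeriv hv hF.1 (j := j + 1) (by omega)
    obtain ⟨hpos, hw⟩ := hv (j + 1) (by omega)
    have hmul : pderiv (genDeriv v j F) = v (j + 1) * genDeriv v (j + 1) F :=
      (hpos.mul_div_cancel _).symm
    refine numZeros_succ_le_of_pderiv (hd.of_le (by omega)) (fun q => hF.2.2 q j (by omega))
      (fun q => ?_) h0 fun hne => ?_
    -- The generalized derivatives have no jumps, so the ordinary derivative changes at a knot by
    -- the ratio of the one-sided values of the weight.
    · refine ⟨v (j + 1) q.succ (X.left q.succ) / v (j + 1) q.castSucc (X.right q.castSucc),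
        div_pos (hpos _ _) (hpos _ _), ?_⟩
      have := (hpos q.castSucc (X.right q.castSucc)).ne'
      rw [hmul]
      simp only [Pi.mul_apply]
      rw [hF.2.2 q (j + 1) (by omega)]
      field_simp
    · rw [hmul] at hne ⊢
      exact (numZeros_mul_le hpos (hw.of_le (by omega)) (hd'.of_le (by omega))).trans
        (ih (j + 1) (by omega) (right_ne_zero_of_mul hne))

/-- If weight functions with first member `1` are associated with a space, then the derivatives
have few zeros. -/
theorem numZeros_pderiv_le {n : ℕ} {v : ℕ → PFun X} (hv : IsWeightSystem (n + 2) v)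
    (hone : v 0 = 1) {F : PFun X} (hF : F ∈ ecpSet (n + 2) v) (h0 : pderiv F ≠ 0) :
    numZeros (n + 1) (pderiv F) ≤ (n : ℕ∞) := by
  have hd' := contDiff_genDeriv hv hF.1 (j := 1) (by omega)
  obtain ⟨hpos, hw⟩ := hv 1 (by omega)
  have hmul : pderiv F = v 1 * genDeriv v 1 F := by
    have h : genDeriv v 0 F = F := by
      change F / v 0 = F
      rw [hone]
      exact div_one F
    change _ = v 1 * (pderiv (genDeriv v 0 F) / v 1)
    rw [hpos.mul_div_cancel, h]
  rw [hmul] at h0 ⊢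
  exact (numZeros_mul_le hpos (hw.of_le (by omega)) (hd'.of_le (by omega))).trans
    (numZeros_genDeriv_le hv hF n 1 (by omega) (right_ne_zero_of_mul h0))

end DerivativeSpaces

/-! ### Existence, uniqueness and independence of transition functions -/

section Transition

variable {k n : ℕ} {X : Knots k} {V : Submodule ℝ (PFun X)}

/-- A space of splines is an ECP-space if its derivatives form one. -/
theorem isECPSpace_of_pderiv (hrank : Module.finrank ℝ V = n + 2)
    (hd : ∀ F ∈ V, PContDiff (n + 1) F) (hK : KnotConn (n + 2) (V : Set (PFun X)))
    (hone : (1 : PFun X) ∈ V) (hE : IsECPSpace (n + 1) (pderiv '' (V : Set (PFun X)))) :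
    IsECPSpace (n + 2) (V : Set (PFun X)) where
  one_le := by omega
  linear := ⟨V, rfl, hrank⟩
  contDiff := hd
  numZeros_le F hF h0 := by
    have hKE := hK.pderiv hone fun F hF => (hd F hF).of_le (by omega)
    refine numZeros_succ_le_of_pderiv ((hd F hF).of_le (by omega)) (hK.pMatch hone hF)
      (fun q => ?_) h0 fun h => hE.numZeros_le _ ⟨F, hF, rfl⟩ h
    obtain ⟨ρ, h1, h2⟩ := hKE q
    exact ⟨ρ 0, h1 0, h2 _ ⟨F, hF, rfl⟩ 0 (by omega) fun s hs => by omega⟩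

theorem eq_zero_of_two_point (hV : IsECPSpace n (V : Set (PFun X)))
    (hK : KnotConn n (V : Set (PFun X))) {F : PFun X} (hF : F ∈ V) {p s : ℕ} (hps : p + s = n)
    (hp : ∀ r < p, segDeriv^[r] (F 0) (X.left 0) = 0)
    (hs : ∀ r < s, segDeriv^[r] (F (Fin.last k)) (X.right (Fin.last k)) = 0) : F = 0 := by
  obtain ⟨t, h1, h2⟩ := exists_between X.first_lt_last
  exact hV.eq_zero_of_three hF h1 h2 (p := p) (q := 0) (s := s)
    (IsTransitionFor.pvanish_left hK hF (by omega) hp) (fun s hs => by omega)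
    (IsTransitionFor.pvanish_right hK hF (by omega) hs) (by omega)

/-- Hermite interpolation at the two end points. -/
theorem exists_two_point (hrank : Module.finrank ℝ V = n) (hV : IsECPSpace n (V : Set (PFun X)))
    (hK : KnotConn n (V : Set (PFun X))) {p s : ℕ} (hps : p + s = n) (y : Fin p → ℝ)
    (z : Fin s → ℝ) : ∃ F ∈ V, (∀ r : Fin p, segDeriv^[(r : ℕ)] (F 0) (X.left 0) = y r) ∧
      ∀ r : Fin s, segDeriv^[(r : ℕ)] (F (Fin.last k)) (X.right (Fin.last k)) = z r := by
  let Φ : V →ₗ[ℝ] (Fin p → ℝ) × (Fin s → ℝ) :=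
    { toFun := fun F => (fun r => segDeriv^[(r : ℕ)] ((F : PFun X) 0) (X.left 0),
        fun r => segDeriv^[(r : ℕ)] ((F : PFun X) (Fin.last k)) (X.right (Fin.last k)))
      map_add' := fun F G => Prod.ext
        (funext fun r => congrFun (segDeriv_iterate_add (X.seg_lt _)
          ((hV.contDiff F F.2 0).of_le (by omega)) ((hV.contDiff G G.2 0).of_le (by omega))) _)
        (funext fun r => congrFun (segDeriv_iterate_add (X.seg_lt _)
          ((hV.contDiff F F.2 _).of_le (by omega)) ((hV.contDiff G G.2 _).of_le (by omega))) _)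
      map_smul' := fun a F => Prod.ext
        (funext fun r => congrFun (segDeriv_iterate_smul (X.seg_lt _)
          ((hV.contDiff F F.2 0).of_le (by omega)) a) _)
        (funext fun r => congrFun (segDeriv_iterate_smul (X.seg_lt _)
          ((hV.contDiff F F.2 _).of_le (by omega)) a) _) }
  have hpos : 0 < Module.finrank ℝ V := hrank ▸ hV.one_le
  have : FiniteDimensional ℝ V := Module.finite_of_finrank_pos hpos
  have hinj : Function.Injective Φ := by
    rw [injective_iff_map_eq_zero]
    intro F hF
    exact Subtype.ext (eq_zero_of_two_point hV hK F.2 hps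
      (fun r hr => congrFun (congrArg Prod.fst hF) ⟨r, hr⟩)
      fun r hr => congrFun (congrArg Prod.snd hF) ⟨r, hr⟩)
  obtain ⟨F, hF⟩ := (LinearMap.injective_iff_surjective_of_finrank_eq_finrank (f := Φ)
    (by rw [hrank, Module.finrank_prod, Module.finrank_fin_fun, Module.finrank_fin_fun, hps])).1
    hinj (y, z)
  exact ⟨F, F.2, fun r => congrFun (congrArg Prod.fst hF) r,
    fun r => congrFun (congrArg Prod.snd hF) r⟩

theorem exists_isTransition (hrank : Module.finrank ℝ V = n)
    (hV : IsECPSpace n (V : Set (PFun X))) (hK : KnotConn n (V : Set (PFun X)))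
    (hone : (1 : PFun X) ∈ V) : ∃ f : ℕ → PFun X, IsTransition n (V : Set (PFun X)) f := by
  have key : ∀ l : ℕ, ∃ F ∈ V, (l = 1 → F = 1) ∧ (l ∈ Finset.Icc 2 n →
      (∀ r, r ≤ l - 2 → (segDeriv^[r] (F 0)) (X.left 0) = 0) ∧
      ∀ r, r ≤ n - l → (segDeriv^[r] (F (Fin.last k))) (X.right (Fin.last k)) =
        if r = 0 then 1 else 0) := by
    intro l
    by_cases hl : l ∈ Finset.Icc 2 n
    · have hl' := Finset.mem_Icc.1 hl
      -- There are l - 1 conditions at a and n + 1 - l at b, matching the dimension n.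
      obtain ⟨F, hF, h1, h2⟩ := exists_two_point hrank hV hK (p := l - 1) (s := n + 1 - l)
        (by omega) 0 (fun r => if (r : ℕ) = 0 then 1 else 0)
      exact ⟨F, hF, fun h => by omega, fun _ => ⟨fun r hr => h1 ⟨r, by omega⟩,
        fun r hr => h2 ⟨r, by omega⟩⟩⟩
    · exact ⟨1, hone, fun _ => rfl, fun h => absurd h hl⟩
  choose f hf using key
  exact ⟨f, fun l _ => (hf l).1, (hf 1).2.1 rfl, fun l hl => ((hf l).2.2 hl).1,
    fun l hl => ((hf l).2.2 hl).2⟩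

/-- The difference of two candidates has l - 1 zeros at a and n + 1 - l at b, which is n in all. -/
theorem IsTransition.unique (hV : IsECPSpace n (V : Set (PFun X)))
    (hK : KnotConn n (V : Set (PFun X))) {f g : ℕ → PFun X}
    (hf : IsTransition n (V : Set (PFun X)) f) (hg : IsTransition n (V : Set (PFun X)) g) {l : ℕ}
    (hl : l ∈ Finset.Icc 1 n) : f l = g l := by
  have hl' := Finset.mem_Icc.1 hl
  rcases hl'.1.eq_or_lt with rfl | h2
  · rw [hf.one, hg.one]
  have hl2 : l ∈ Finset.Icc 2 n := Finset.mem_Icc.2 ⟨h2, hl'.2⟩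
  have hsub : ∀ r ≤ n - 1, ∀ i (t : X.Seg i),
      segDeriv^[r] ((f l + (-1 : ℝ) • g l) i) t =
        segDeriv^[r] (f l i) t - segDeriv^[r] (g l i) t := by
    intro r hr i t
    have h1 := (hV.contDiff _ (hf.mem l hl) i).of_le hr
    have h2 := (hV.contDiff _ (hg.mem l hl) i).of_le hr
    have e := congrFun (segDeriv_iterate_add (X.seg_lt i) h1 (h2.smul (-1))) t
    rw [segDeriv_iterate_smul (X.seg_lt i) h2] at e
    simp only [Pi.add_apply, Pi.smul_apply, smul_eq_mul] at e ⊢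
    rw [e]
    ring
  have h0 := eq_zero_of_two_point hV hK (V.add_mem (hf.mem l hl) (V.smul_mem (-1) (hg.mem l hl)))
    (p := l - 1) (s := n + 1 - l) (by omega)
    (fun r hr => by
      rw [hsub r (by omega), hf.at_left l hl2 r (by omega), hg.at_left l hl2 r (by omega), sub_zero])
    (fun r hr => by
      rw [hsub r (by omega), hf.at_right l hl2 r (by omega), hg.at_right l hl2 r (by omega),
        sub_self])
  rw [neg_one_smul, add_neg_eq_zero] at h0
  exact h0

theorem IsTransition.isTransitionFor {E : Submodule ℝ (PFun X)}
    (hd : ∀ F ∈ V, PContDiff n F) (hm : ∀ F ∈ V, PMatch F)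
    (hE : (E : Set (PFun X)) = pderiv '' (V : Set (PFun X))) {f : ℕ → PFun X}
    (hf : IsTransition (n + 1) (V : Set (PFun X)) f) : IsTransitionFor n E f where
  one := hf.one
  contDiff l hl := hd _ (hf.mem l hl)
  noJump l hl := hm _ (hf.mem l hl)
  mem l hl := by
    rw [Finset.mem_Icc] at hl
    rw [← SetLike.mem_coe, hE]
    exact ⟨f l, hf.mem l (Finset.mem_Icc.2 ⟨by omega, hl.2⟩), rfl⟩
  left_zero l hl s hs := hf.at_left l hl (s + 1) (by omega)
  right_zero l hl s hs :=
    (hf.at_right l hl (s + 1) (by omega)).trans (if_neg (Nat.succ_ne_zero s))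
  left_val l hl := hf.at_left l hl 0 (by omega)
  right_val l hl := by
    simpa using hf.at_right l hl 0 (by omega)

/-- Differentiation removes the constant function f_1, and the remaining derivatives are independent
by their Wronskian near a; then the coefficient of 1 vanishes too. -/
theorem IsTransitionFor.linearIndependent {E : Submodule ℝ (PFun X)}
    (hE : IsECPSpace n (E : Set (PFun X))) (hK : KnotConn n (E : Set (PFun X)))
    {f : ℕ → PFun X} (hf : IsTransitionFor n E f) :
    LinearIndependent ℝ (fun l : Finset.Icc 1 (n + 1) => f l) := by
  rw [linearIndependent_iff']
  intro s
  have key : ∀ c : ℕ → ℝ, ∑ l ∈ Finset.Icc 1 (n + 1), c l • f l = 0 →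
      ∀ l ∈ Finset.Icc 1 (n + 1), c l = 0 := by
    intro c hc
    have h1 := congrArg pderiv hc
    rw [pderiv_sum_smul fun l hl => (hf.contDiff l hl).of_le hE.one_le,
      ← Finset.add_sum_Ioc_eq_sum_Icc (by omega), hf.one,
      show pderiv (1 : PFun X) = 0 from pderiv_const 1,
      show pderiv (0 : PFun X) = 0 from pderiv_const 0, smul_zero, zero_add,
      ← Finset.Icc_add_one_left_eq_Ioc, ← Finset.Ico_add_one_right_eq_Icc,
      Finset.sum_Ico_eq_sum_range, ← Fin.sum_univ_eq_sum_range
        (fun q => c (1 + 1 + q) • pderiv (f (1 + 1 + q)))] at h1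
    have h2 := hf.combination_eq_zero hE hK (J := fun q => 1 + 1 + (q : ℕ))
      (fun a b hab => by
        have : (a : ℕ) < b := hab
        simpa using this) (fun q => by omega) (by omega) h1
    have h3 : ∀ l ∈ Finset.Ioc 1 (n + 1), c l = 0 := by
      intro l hl
      rw [Finset.mem_Ioc] at hl
      have := congrFun h2 ⟨l - 2, by omega⟩
      simpa [show 1 + 1 + (l - 2) = l by omega] using this
    intro l hl
    rw [← Finset.add_sum_Ioc_eq_sum_Icc (by omega), Finset.sum_eq_zero fun l hl => by
      rw [h3 l hl, zero_smul], add_zero, hf.one] at hc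
    have hc1 : c 1 = 0 := by simpa using congrFun (congrFun hc 0) (X.left 0)
    rw [Finset.mem_Icc] at hl
    rcases hl.1.eq_or_lt with rfl | h
    · exact hc1
    · exact h3 l (Finset.mem_Ioc.2 ⟨h, hl.2⟩)
  intro g hg l hl
  classical
  have := key (fun l => if h : l ∈ Finset.Icc 1 (n + 1) then
    (if (⟨l, h⟩ : Finset.Icc 1 (n + 1)) ∈ s then g ⟨l, h⟩ else 0) else 0) (by
      rw [← Finset.sum_coe_sort, ← hg, ← Finset.sum_subset (Finset.subset_univ s)]
      · refine Finset.sum_congr rfl fun q hq => ?_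
        rw [dif_pos q.2, if_pos hq]
      · intro q _ hq
        rw [dif_pos q.2, if_neg hq, zero_smul]) l l.2
  rwa [dif_pos l.2, if_pos hl] at this

theorem levelSpan_eq (hrank : Module.finrank ℝ V = n + 1) {f : ℕ → PFun X}
    (hf : IsTransition (n + 1) (V : Set (PFun X)) f)
    (hli : LinearIndependent ℝ (fun l : Finset.Icc 1 (n + 1) => f l)) :
    levelSpan (n + 1) f = V := by
  have : FiniteDimensional ℝ V := Module.finite_of_finrank_pos (by omega)
  refine Submodule.eq_of_le_of_finrank_eq (Submodule.span_le.2 ?_) ?_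
  · rintro _ ⟨l, hl, rfl⟩
    exact hf.mem l hl
  · have h := finrank_span_eq_card hli
    rw [hrank, levelSpan, Set.image_eq_range]
    simpa using h

end Transition

end PCSpline

/-! ### The proposition -/

theorem mainTheorem1 {k m : ℕ} (X : PCSpline.Knots k)
    (U : (i : Fin (k + 1)) → Submodule ℝ (X.Seg i → ℝ))
    (R : Fin k → Matrix (Fin m) (Fin m) ℝ)
    (hU : ∀ i, PCSpline.IsECSpace m (U i))
    (hR : ∀ i, PCSpline.IsConnectionMatrix (R i))
    (S DS : Set (PCSpline.PFun X))
    (hS : S = PCSpline.splineSpace X U R)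
    (hDS : DS = PCSpline.derivSpace S)
    (hconst : ∀ c : ℝ, (fun _ _ => c : PCSpline.PFun X) ∈ S) :
    (PCSpline.IsECPSpace (m - 1) DS →
      PCSpline.IsECPSpace m S ∧
      (∃ f : ℕ → PCSpline.PFun X, PCSpline.IsTransition m S f) ∧
      (∀ f g : ℕ → PCSpline.PFun X, PCSpline.IsTransition m S f → PCSpline.IsTransition m S g →
        ∀ l ∈ Finset.Icc 1 m, f l = g l) ∧
      ∀ f : ℕ → PCSpline.PFun X, PCSpline.IsTransition m S f →
        LinearIndependent ℝ (fun l : Finset.Icc 1 m => f l) ∧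
        (∀ j ∈ Finset.Icc 1 (m - 1), PCSpline.PPositive (PCSpline.weight m f j)) ∧
        PCSpline.IsAssociated m (PCSpline.weight m f) S ∧
        PCSpline.IsAssociated (m - 1) (fun j => PCSpline.weight m f (j + 1)) DS) ∧
    (∀ f : ℕ → PCSpline.PFun X, PCSpline.IsTransition m S f →
      (∃ j ∈ Finset.Icc 1 (m - 1), ¬ PCSpline.PPositive (PCSpline.weight m f j)) →
        ¬ PCSpline.IsECPSpace (m - 1) DS ∧
        ∀ v : ℕ → PCSpline.PFun X, v 0 = 1 → ¬ PCSpline.IsAssociated m v S) := by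
  open PCSpline in
  -- For m < 2 both parts are vacuous: an ECP-space has dimension at least 1, and there is no index
  -- j.
  rcases Nat.lt_or_ge m 2 with hm | hm
  · refine ⟨fun h => absurd h.one_le (by omega), ?_⟩
    rintro f - ⟨j, hj, -⟩
    rw [Finset.mem_Icc] at hj
    omega
  obtain ⟨n, rfl⟩ := Nat.exists_eq_add_of_le' hm
  set V := splineSubmodule X U R with hVdef
  obtain rfl : S = (V : Set (PFun X)) := hS
  rw [show n + 2 - 1 = n + 1 by omega]
  have hd : ∀ F ∈ V, PContDiff (n + 1) F := fun F hF => hF.1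
  have hd1 : ∀ F ∈ V, PContDiff 1 F := fun F hF => (hd F hF).of_le (by omega)
  have hone : (1 : PFun X) ∈ V := hconst 1
  have hrank : Module.finrank ℝ V = n + 2 := finrank_splineSubmodule hU
  have hfin : Module.Finite ℝ V := finite_splineSubmodule hU
  have hK : KnotConn (n + 2) (V : Set (PFun X)) := knotConn_splineSubmodule hR
  have hmatch : ∀ F ∈ V, PMatch F := fun F hF => hK.pMatch hone hF
  set E : Submodule ℝ (PFun X) := LinearMap.range (pderivLinear V hd1) with hEdef
  have hEcoe : (E : Set (PFun X)) = pderiv '' (V : Set (PFun X)) := coe_range_pderivLinear V hd1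
  have hrankE : Module.finrank ℝ E = n + 1 := by
    have : Module.finrank ℝ E + 1 = _ := finrank_range_pderivLinear V hd1 hone hmatch
    omega
  have hKE : KnotConn (n + 1) (E : Set (PFun X)) := hEcoe ▸ hK.pderiv hone hd1
  obtain rfl : DS = (E : Set (PFun X)) := hDS.trans hEcoe.symm
  have main : IsECPSpace (n + 1) (E : Set (PFun X)) → ∀ f : ℕ → PFun X,
      IsTransition (n + 2) (V : Set (PFun X)) f →
        LinearIndependent ℝ (fun l : Finset.Icc 1 (n + 2) => f l) ∧
        (∀ j ∈ Finset.Icc 1 (n + 1), PPositive (weight (n + 2) f j)) ∧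
        IsAssociated (n + 2) (weight (n + 2) f) (V : Set (PFun X)) ∧
        IsAssociated (n + 1) (fun j => weight (n + 2) f (j + 1)) (E : Set (PFun X)) := by
    intro hE f hf
    have hfE : IsTransitionFor (n + 1) E f := hf.isTransitionFor hd hmatch hEcoe
    have hT := hfE.isTotallyPositiveLevel hE hKE
    have hli := hfE.linearIndependent hE hKE
    have hspan := levelSpan_eq hrank hf hli
    have hK' : KnotConn (n + 2) (levelSpan (n + 2) f : Set (PFun X)) := hspan ▸ hK
    refine ⟨hli, fun j hj => (weight_pos_and_contDiff hT (j := j) ?_).1, ?_, ?_⟩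
    · rw [Finset.mem_Icc] at hj
      omega
    · have := isAssociated_levelSpan (by omega) hT hK'
      rwa [hspan] at this
    · have := isAssociated_pderiv_levelSpan (by omega) hT hK'
      rwa [hspan, ← hEcoe] at this
  refine ⟨fun hE => ?_, ?_⟩
  · have hV := isECPSpace_of_pderiv hrank hd hK hone (hEcoe ▸ hE)
    exact ⟨hV, exists_isTransition hrank hV hK hone,
      fun f g hf hg l hl => hf.unique hV hK hg hl, main hE⟩
  · rintro f hf ⟨j, hj, hjpos⟩
    have hnot : ¬ IsECPSpace (n + 1) (E : Set (PFun X)) := fun hE =>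
      hjpos ((main hE f hf).2.1 j hj)
    -- Dimension and smoothness of DS hold unconditionally, so associated weights need only supply
    -- the bound on zeros to make it an ECP-space.
    refine ⟨hnot, fun v hv0 hv => hnot ⟨by omega, ⟨E, rfl, hrankE⟩, ?_, ?_⟩⟩
    · rw [hEcoe]
      rintro _ ⟨F, hF, rfl⟩
      exact (hd F hF).pderiv
    · rw [hEcoe]
      rintro _ ⟨F, hF, rfl⟩ h0
      exact numZeros_pderiv_le hv.1 hv0 (hv.2 ▸ hF) h0
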